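/- Let $p$ be a prime and let $X$ be a finite connected directed graph (loops and multiple edges are allowed; connected means that the undirected graph obtained by forgetting directions is connected). Let $\tilde X$ be the directed graph obtained from $X$ by adding, for each edge $e$ of $X$, a supplementary edge $e^\iota$ in the opposite direction; the weight of a directed path in $\tilde X$ is the number of its edges that belong to $X$ minus the number of its supplementary edges. Suppose that $\tilde X$ contains a directed cycle of nonzero weight. For a unit $a\in\mathbb{Z}_p^\times$ let $X_n$ ($n\ge 0$) be the derived graph of the constant voltage assignment $a \bmod p^n$: its vertices are $\mathbb{V}(X)\times\mathbb{Z}/p^n\mathbb{Z}$, its edges are $\mathbb{E}(X)\times\mathbb{Z}/p^n\mathbb{Z}$, and if $e$ goes from $s$ to $t$ then $(e,\sigma)$ goes from $(s,\sigma)$ to $(t,\sigma+a)$. Then the number $r_n$ of connected components of $X_n$ is eventually constant. Let $n_0$ be the smallest index with $r_n=r_{n_0}$ for all $n\ge n_0$, let $\hat X_{n_0}$ be a connected component of $X_{n_0}$, for $m\ge 0$ let $\hat X_{n_0+m}$ be the pre-image of $\hat X_{n_0}$ in $X_{n_0+m}$, and let $\kappa_m$ be the number of spanning trees of the undirected graph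 underlying $\hat X_{n_0+m}$. Then there are integers $\mu,\lambda,\nu$ such that $$\operatorname{ord}_p(\kappa_m)=\mu p^m+\lambda m+\nu\qquad\text{for all sufficiently large } m,$$ and $\mu=:\mu(X)$ does not depend on the choice of $a$ and of the component $\hat X_{n_0}$. Moreover: (a) If $p$ divides the in-degree and the out-degree of each vertex of $X$, then $\mu(X)>0$. (b) If the sum of the in-degree and the out-degree is equal to the same number $k$ for every vertex of $X$, with $p\nmid k$, and the adjacency matrix $A$ of $X$ is normal ($AA^{t}=A^{t}A$), then $\mu(X)=0$. -/

import Mathlib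

universe u v w

/-- A directed graph with vertex type `V` and edge type `E`; loops and multiple edges are allowed.
The edge `e` goes from `src e` to `tgt e`. -/
structure DiMultigraph (V : Type u) (E : Type v) where
  src : E → V
  tgt : E → V

namespace DiMultigraph

variable {V : Type u} {E : Type v}

/-- The number of edges going out of `x`. -/
noncomputable def outDegree (X : DiMultigraph V E) (x : V) : ℕ := Nat.card {e : E // X.src e = x}

/-- The number of edges coming into `x`. -/
noncomputable def inDegree (X : DiMultigraph V E) (x : V) : ℕ := Nat.card {e : E // X.tgt e = x}

/-- The adjacency matrix: the `(x, y)` entry is the number of edges from `x` to `y`. -/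
noncomputable def adjMatrix (X : DiMultigraph V E) : Matrix V V ℤ :=
  Matrix.of fun x y => (Nat.card {e : E // X.src e = x ∧ X.tgt e = y} : ℤ)

/-- The simple graph joining distinct vertices that are joined by at least one edge, in either
direction. It has the same connectivity as the image of `X` under the forgetful map. -/
def toSimpleGraph (X : DiMultigraph V E) : SimpleGraph V :=
  SimpleGraph.fromRel fun x y => ∃ e, X.src e = x ∧ X.tgt e = y

/-- `X` is connected if the undirected graph obtained by forgetting directions is connected. -/
def Connected (X : DiMultigraph V E) : Prop := X.toSimpleGraph.Connected

/-- The graph with the same vertices as `X` and, besides each edge `e` of `X` (as `Sum.inl e`),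
a supplementary edge `Sum.inr e` in the opposite direction. -/
def double (X : DiMultigraph V E) : DiMultigraph V (E ⊕ E) where
  src := Sum.elim X.src X.tgt
  tgt := Sum.elim X.tgt X.src

/-- The list of edges is a directed path from `x` to `y`. -/
def IsPath (X : DiMultigraph V E) : V → V → List E → Prop
  | x, y, [] => x = y
  | x, y, e :: l => X.src e = x ∧ X.IsPath (X.tgt e) y l

/-- The weight of a path in the doubled graph: the number of its edges that belong to the original
graph minus the number of its supplementary edges. -/
def pathWeight (l : List (E ⊕ E)) : ℤ := (l.map (Sum.elim (fun _ => 1) (fun _ => -1))).sum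

/-- The doubled graph of `X` contains a directed cycle (closed directed path) of nonzero weight.
Asking in addition that no vertex be repeated gives the same condition, because a closed path splits
into cycles without repeated vertices and weights add up. -/
def HasCycleOfNonzeroWeight (X : DiMultigraph V E) : Prop :=
  ∃ (x : V) (l : List (E ⊕ E)), X.double.IsPath x x l ∧ pathWeight l ≠ 0

/-- The derived graph of a voltage assignment `α` with values in an additive group `G`. -/
def derived (X : DiMultigraph V E) (G : Type w) [AddGroup G] (α : E → G) :
    DiMultigraph (V × G) (E × G) where
  src e := (X.src e.1, e.2)
  tgt e := (X.tgt e.1, e.2 + α e.1)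

/-- The subgraph of `X` induced by a set of vertices. -/
def induce (X : DiMultigraph V E) (W : Set V) :
    DiMultigraph W {e : E // X.src e ∈ W ∧ X.tgt e ∈ W} where
  src e := ⟨X.src e.1, e.2.1⟩
  tgt e := ⟨X.tgt e.1, e.2.2⟩

/-- The two end points of an edge, without direction. -/
def ends (X : DiMultigraph V E) (e : E) : Sym2 V := s(X.src e, X.tgt e)

/-- The set `S` of edges is (the edge set of) a spanning tree of the undirected multigraph obtained
by forgetting directions: it has no loops, no two parallel edges, and joins up all vertices to
a tree. -/
def IsSpanningTree (X : DiMultigraph V E) (S : Set E) : Prop :=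
  (∀ e ∈ S, ¬ (X.ends e).IsDiag) ∧ Set.InjOn X.ends S ∧
    (SimpleGraph.fromEdgeSet (X.ends '' S)).IsTree

/-- The number of spanning trees of the undirected multigraph obtained by forgetting directions. -/
noncomputable def numSpanningTrees (X : DiMultigraph V E) : ℕ :=
  Nat.card {S : Set E // X.IsSpanningTree S}

section Tower

variable (p : ℕ) [Fact p.Prime]

/-- The `n`-th layer attached to the constant `ℤ_p`-valued voltage assignment with value `a`: the
derived graph of the reduction of this assignment modulo `p ^ n`. -/
noncomputable def layer (X : DiMultigraph V E) (a : ℤ_[p]) (n : ℕ) :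
    DiMultigraph (V × ZMod (p ^ n)) (E × ZMod (p ^ n)) :=
  X.derived (ZMod (p ^ n)) fun _ => PadicInt.toZModPow n a

/-- The number of connected components of the `n`-th layer. -/
noncomputable def numComponents (X : DiMultigraph V E) (a : ℤ_[p]) (n : ℕ) : ℕ :=
  Nat.card (X.layer p a n).toSimpleGraph.ConnectedComponent

/-- `n₀` is the smallest index from which on the number of connected components of the layers is
constant. -/
def IsStableIndex (X : DiMultigraph V E) (a : ℤ_[p]) (n₀ : ℕ) : Prop :=
  IsLeast {m : ℕ | ∀ n, m ≤ n → X.numComponents p a n = X.numComponents p a m} n₀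

/-- The vertices of the `(n₀ + m)`-th layer that lie above the connected component `c` of the
`n₀`-th layer. -/
def verticesAbove (X : DiMultigraph V E) (a : ℤ_[p]) (n₀ : ℕ)
    (c : (X.layer p a n₀).toSimpleGraph.ConnectedComponent) (m : ℕ) :
    Set (V × ZMod (p ^ (n₀ + m))) :=
  {x | (x.1, ZMod.castHom (pow_dvd_pow p (Nat.le_add_right n₀ m)) (ZMod (p ^ n₀)) x.2) ∈ c.supp}

/-- The pre-image in the `(n₀ + m)`-th layer of the connected component `c` of the `n₀`-th layer.
For `n₀` the stable index, this is the layer with Galois group `ℤ/p^m` of the constant `ℤ_p`-tower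
that starts at `c`. -/
noncomputable def towerLayer (X : DiMultigraph V E) (a : ℤ_[p]) (n₀ : ℕ)
    (c : (X.layer p a n₀).toSimpleGraph.ConnectedComponent) (m : ℕ) :=
  (X.layer p a (n₀ + m)).induce (X.verticesAbove p a n₀ c m)

/-- `μ` is the `μ`-invariant of `X`, that is, of the constant `ℤ_p`-towers over `X`. For every unit
`a` of `ℤ_p`, the number of connected components of the layers becomes stable, say from the index
`n₀` on, and for every connected component of the `n₀`-th layer, the number `κ m` of spanning trees
of its pre-image in the `(n₀ + m)`-th layer satisfies `ord_p (κ m) = μ p^m + lam m + ν`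
for all large `m`, where `lam` and `ν` are integers. There is at most one such `μ`. -/
def HasMuInvariant (X : DiMultigraph V E) (μ : ℤ) : Prop :=
  ∀ a : ℤ_[p], IsUnit a →
    ∃ n₀ : ℕ, X.IsStableIndex p a n₀ ∧
      ∀ c : (X.layer p a n₀).toSimpleGraph.ConnectedComponent,
        ∃ lam ν : ℤ, ∀ᶠ m : ℕ in Filter.atTop,
          (padicValNat p (X.towerLayer p a n₀ c m).numSpanningTrees : ℤ)
            = μ * (p : ℤ) ^ m + lam * (m : ℤ) + ν

end Tower

end DiMultigraph

/-! Lift the constant voltage to `ℤ`. The weights of closed walks form a group `dℤ` with `d ≠ 0`,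
and there is a potential `h` such that `d` divides `1 + h (src e) - h (tgt e)` for every edge. Write
`d = p ^ n₀ * d'` with `d'` prime to `p`. The `n`-th layer has `p ^ min n n₀` components, so `n₀` is
the stable index. Rescaling fibres by `a` and shifting them by `h` identifies every tower over a
component of the stable layer with the derived graphs of `X` for the voltage `α e = (1 + h (src e) -
h (tgt e)) / p ^ n₀`. Neither the unit `a` nor the component appears in `α`, hence the independence
of `μ` (`numSpanningTrees_towerLayer`).

The matrix-tree theorem and the decomposition of the Laplacian by characters of `ℤ/p^m` give `p ^ m
* κ_m = κ(X) * ∏ D(η)`, where `η ≠ 1` runs over the `p ^ m`-th roots of unity and `D(T) = det L(T ^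
α)` is an integral Laurent polynomial (`numSpanningTrees_derived`). Grouped by exact order, the
factors are norms from cyclotomic rings. For large `k` the norm at level `p ^ k` has valuation `μ
φ(p ^ k) + l`, where `p ^ μ` is the `p`-part of the content of `D` and `l` is the order of vanishing
at `1` of `D / p ^ μ` modulo `p` (`exists_padicValInt_cyclotomicNorm_eq`). Summing over the levels
telescopes to the growth formula.

Thus `μ = 0` exactly when `D` is nonzero modulo `p`. Replacing `T` by `T ^ (p ^ n₀)` does not affect
this, and a diagonal conjugation by `T ^ h` then turns the voltage into the constant one; so what
matters is `det (Deg - T A - T⁻¹ Aᵗ)` over `𝔽_p`, with `Deg` the matrix of total degrees. In (a) the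
all-ones vector lies in the kernel. In (b) a degree argument using that `A` and `Aᵗ` commute
excludes a kernel (`Matrix.det_quadratic_ne_zero_of_commute`). -/

/-! ### Cauchy–Binet and the matrix-tree theorem -/

open Matrix in
/-- The Cauchy–Binet formula. -/
theorem Matrix.det_mul_eq_sum_powersetCard {n m R : Type*} [Fintype n] [DecidableEq n] [Fintype m]
    [DecidableEq m] [CommRing R] (A : Matrix n m R) (B : Matrix m n R) :
    (A * B).det = ∑ S ∈ Finset.powersetCard (Fintype.card n) (Finset.univ : Finset m),
      (A.submatrix id (Subtype.val : {x // x ∈ S} → m) *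
        B.submatrix (Subtype.val : {x // x ∈ S} → m) id).det := by
  classical
  have expand : ∀ (k : Type _) [Fintype k] (A : Matrix n k R) (B : Matrix k n R),
      (A * B).det = ∑ f : n → k, (∏ i, A i (f i)) * (B.submatrix f id).det := by
    intro k _ A B
    have h1 : A * B = fun i => ∑ j, A i j • B j := by
      ext i j
      simp [Matrix.mul_apply]
    rw [h1]
    have h2 := (Matrix.detRowAlternating (R := R) (n := n)).toMultilinearMap.map_sum
      (fun i (j : k) => A i j • B j)
    refine h2.trans (Finset.sum_congr rfl fun f _ => ?_)
    exact (Matrix.detRowAlternating (R := R) (n := n)).toMultilinearMap.map_smul_univ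
      (fun i => A i (f i)) (fun i => B (f i))
  have expandS : ∀ S : Finset m, (A.submatrix id (Subtype.val : {x // x ∈ S} → m) *
        B.submatrix (Subtype.val : {x // x ∈ S} → m) id).det =
      ∑ f : n → m, if ∀ i, f i ∈ S then (∏ i, A i (f i)) * (B.submatrix f id).det else 0 := by
    intro S
    rw [expand, ← Finset.sum_filter]
    refine Finset.sum_bij (fun f _ i => (f i : m)) ?_ ?_ ?_ ?_
    · intro f _
      simp
    · intro f _ g _ h
      funext i
      exact Subtype.ext (congrFun h i)
    · intro f hf
      simp only [Finset.mem_filter, Finset.mem_univ, true_and] at hf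
      exact ⟨fun i => ⟨f i, hf i⟩, Finset.mem_univ _, rfl⟩
    · intro f _
      rfl
  rw [expand, Finset.sum_congr rfl fun S _ => expandS S, Finset.sum_comm]
  refine Finset.sum_congr rfl fun f _ => ?_
  by_cases hf : Function.Injective f
  · rw [Finset.sum_eq_single (Finset.univ.image f)]
    · simp
    · intro S hS hne
      rw [if_neg]
      intro h
      apply hne
      symm
      apply Finset.eq_of_subset_of_card_le
      · intro x hx
        obtain ⟨i, _, rfl⟩ := Finset.mem_image.1 hx
        exact h i
      · rw [(Finset.mem_powersetCard.1 hS).2, Finset.card_image_of_injective _ hf, Finset.card_univ]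
    · intro h
      exact absurd (Finset.mem_powersetCard.2 ⟨Finset.subset_univ _, by
        rw [Finset.card_image_of_injective _ hf, Finset.card_univ]⟩) h
  · simp only [Function.Injective, not_forall] at hf
    obtain ⟨i, j, hij, hne⟩ := hf
    have : (B.submatrix f id).det = 0 := by
      apply Matrix.det_zero_of_row_eq hne
      funext k
      simp [hij]
    simp [this]

namespace SimpleGraph

/-- A function that takes equal values at adjacent vertices is constant on connected components. -/
theorem Reachable.apply_eq {V β : Type*} {G : SimpleGraph V} {f : V → β}
    (hf : ∀ x y, G.Adj x y → f x = f y) {x y : V} (h : G.Reachable x y) : f x = f y := by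
  obtain ⟨w⟩ := h
  induction w with
  | nil => rfl
  | cons h _ ih => exact (hf _ _ h).trans ih

end SimpleGraph

namespace DiMultigraph

variable {V : Type u} {E : Type v}

section MatrixTree

/-- The simple graph spanned by a set of edges. -/
def spanned (X : DiMultigraph V E) (S : Set E) : SimpleGraph V :=
  SimpleGraph.fromEdgeSet (X.ends '' S)

theorem spanned_adj {X : DiMultigraph V E} {S : Set E} {x y : V} :
    (X.spanned S).Adj x y ↔
      (∃ e ∈ S, (X.src e = x ∧ X.tgt e = y) ∨ (X.src e = y ∧ X.tgt e = x)) ∧ x ≠ y := by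
  simp [spanned, ends]

theorem spanned_reachable {X : DiMultigraph V E} {S : Set E} {e : E} (he : e ∈ S) :
    (X.spanned S).Reachable (X.src e) (X.tgt e) := by
  by_cases h : X.src e = X.tgt e
  · rw [h]
  · exact (spanned_adj.2 ⟨⟨e, he, Or.inl ⟨rfl, rfl⟩⟩, h⟩).reachable

/-- A connected graph on `V` needs at least `|V| - 1` edges. Loops and parallel edges in `S` are
lost in `spanned`, so when `S` has exactly `|V| - 1` elements there can be none, and the count gives
a tree. -/
theorem isSpanningTree_iff [Finite V] [Finite E] {X : DiMultigraph V E} {S : Set E} :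
    X.IsSpanningTree S ↔ (X.spanned S).Connected ∧ S.ncard + 1 = Nat.card V := by
  have hedge : (X.spanned S).edgeSet = X.ends '' S \ Sym2.diagSet :=
    SimpleGraph.edgeSet_fromEdgeSet _
  constructor
  · rintro ⟨hdiag, hinj, htree⟩
    obtain ⟨hc, hcard⟩ := SimpleGraph.isTree_iff_connected_and_card.1 htree
    refine ⟨hc, ?_⟩
    rw [← hcard, Nat.card_coe_set_eq]
    change _ = (X.spanned S).edgeSet.ncard + 1
    rw [hedge, sdiff_eq_left.2, hinj.ncard_image]
    rw [Set.disjoint_left]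
    rintro _ ⟨e, he, rfl⟩ h
    exact hdiag e he h
  · rintro ⟨hc, hcard⟩
    have h1 := hc.card_vert_le_card_edgeSet_add_one
    rw [Nat.card_coe_set_eq, ← hcard] at h1
    have h2 : (X.spanned S).edgeSet ⊆ X.ends '' S := hedge ▸ Set.sdiff_subset
    have h3 := Set.ncard_image_le (f := X.ends) S.toFinite
    have h4 := Set.ncard_le_ncard h2 (Set.toFinite _)
    have h5 : (X.spanned S).edgeSet = X.ends '' S :=
      Set.eq_of_subset_of_ncard_le h2 (by omega) (Set.toFinite _)
    refine ⟨?_, ?_, ?_⟩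
    · intro e he hd
      have : X.ends e ∈ (X.spanned S).edgeSet := h5 ▸ Set.mem_image_of_mem _ he
      exact (hedge ▸ this).2 hd
    · exact (Set.ncard_image_iff S.toFinite).1 (by omega)
    · refine SimpleGraph.isTree_iff_connected_and_card.2 ⟨hc, ?_⟩
      change Nat.card (X.spanned S).edgeSet + 1 = _
      rw [Nat.card_coe_set_eq]
      omega

variable [DecidableEq V]

/-- The incidence matrix of a directed graph with one additional column, the indicator of
the root. -/
def rootedIncidence (X : DiMultigraph V E) (r : V) : Matrix V (Option E) ℤ :=
  fun x o => o.elim (Pi.single r (1 : ℤ) : V → ℤ)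
    (fun e => (Pi.single (X.src e) 1 - Pi.single (X.tgt e) 1 : V → ℤ)) x

/-- The columns span `ℤ^V`: the root column is the basis vector at `r`, and a chosen edge shows that
the basis vectors at its two ends lie in the span together or not at all. -/
theorem det_rootedIncidence_of_connected [Fintype V] (X : DiMultigraph V E) (r : V)
    (c : V → Option E) (hnone : none ∈ Set.range c)
    (hc : (X.spanned {e | some e ∈ Set.range c}).Connected) :
    IsUnit ((X.rootedIncidence r).submatrix id c).det := by
  rw [← Matrix.isUnit_iff_isUnit_det, ← Matrix.mulVec_surjective_iff_isUnit]
  set M := (X.rootedIncidence r).submatrix id c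
  let N := LinearMap.range M.mulVecLin
  have hcol : ∀ o ∈ Set.range c, (fun x => X.rootedIncidence r x o) ∈ N := by
    rintro _ ⟨y, rfl⟩
    exact ⟨Pi.single y 1, by ext x; simp [M]⟩
  have hroot : (Pi.single r 1 : V → ℤ) ∈ N := hcol none hnone
  have hmem : ∀ x, (Pi.single x 1 : V → ℤ) ∈ N := by
    intro x
    have key := (hc r x).apply_eq (f := fun y => (Pi.single y 1 : V → ℤ) ∈ N) ?_
    · exact key.mp hroot
    · intro x y hxy
      obtain ⟨⟨e, he, h⟩, -⟩ := spanned_adj.1 hxy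
      have h1 := hcol _ he
      have h2 : (fun x => X.rootedIncidence r x (some e)) =
        (Pi.single (X.src e) 1 - Pi.single (X.tgt e) 1 : V → ℤ) := rfl
      rw [h2] at h1
      have h3 : (Pi.single (X.src e) 1 : V → ℤ) ∈ N ↔ (Pi.single (X.tgt e) 1 : V → ℤ) ∈ N :=
        ⟨fun h => by simpa using N.sub_mem h h1, fun h => by simpa using N.add_mem h h1⟩
      rcases h with ⟨rfl, rfl⟩ | ⟨rfl, rfl⟩
      · exact propext h3
      · exact propext h3.symm
  intro z
  have hz : z ∈ N := by
    rw [pi_eq_sum_univ' z]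
    refine N.sum_mem fun i _ => N.smul_mem _ ?_
    convert hmem i using 1
  exact hz

/-- A left kernel vector is a function that is constant along the chosen edges and, if the root
column is present, zero at `r`: the constant `1` without the root column, otherwise the indicator of
the vertices not reachable from `r`. -/
theorem det_rootedIncidence_of_not_connected [Fintype V] (X : DiMultigraph V E) (r : V)
    (c : V → Option E)
    (hc : ¬ (none ∈ Set.range c ∧ (X.spanned {e | some e ∈ Set.range c}).Connected)) :
    ((X.rootedIncidence r).submatrix id c).det = 0 := by
  classical
  rw [← Matrix.exists_vecMul_eq_zero_iff]
  have key : ∀ u : V → ℤ, (none ∈ Set.range c → u r = 0) →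
      (∀ e, some e ∈ Set.range c → u (X.src e) = u (X.tgt e)) →
      Matrix.vecMul u ((X.rootedIncidence r).submatrix id c) = 0 := by
    intro u hu hu'
    ext y
    simp only [Matrix.vecMul, dotProduct, Matrix.submatrix_apply, id, Pi.zero_apply]
    have hy : c y ∈ Set.range c := ⟨y, rfl⟩
    cases ho : c y with
    | none => simpa [rootedIncidence, Pi.single_apply] using hu (ho ▸ hy)
    | some e =>
      simpa [rootedIncidence, Pi.single_apply, mul_sub, sub_eq_zero] using hu' e (ho ▸ hy)
  by_cases hnone : none ∈ Set.range c
  · have hc' : ¬ (X.spanned {e | some e ∈ Set.range c}).Connected := fun h => hc ⟨hnone, h⟩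
    rw [SimpleGraph.connected_iff_exists_forall_reachable] at hc'
    simp only [not_exists, not_forall] at hc'
    obtain ⟨x, hx⟩ := hc' r
    refine ⟨fun y => if (X.spanned {e | some e ∈ Set.range c}).Reachable r y then 0 else 1,
      fun h => ?_, key _ (fun _ => by simp) ?_⟩
    · have := congrFun h x
      simp only [Pi.zero_apply, ite_eq_left_iff, one_ne_zero, imp_false, not_not] at this
      exact hx this
    · intro e he
      have h1 := spanned_reachable (X := X) (S := {e | some e ∈ Set.range c}) he
      have : (X.spanned {e | some e ∈ Set.range c}).Reachable r (X.src e) ↔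
          (X.spanned {e | some e ∈ Set.range c}).Reachable r (X.tgt e) :=
        ⟨fun h => h.trans h1, fun h => h.trans h1.symm⟩
      simp only [this]
  · refine ⟨fun _ => 1, fun h => ?_, key _ (fun h => absurd h hnone) fun _ _ => rfl⟩
    simpa using congrFun h r

/-- The matrix-tree theorem, for the Laplacian made invertible by adding `1` at the entry of
a root. -/
theorem det_rootedIncidence_mul_transpose [Fintype V] [Fintype E] (X : DiMultigraph V E) (r : V) :
    (X.rootedIncidence r * (X.rootedIncidence r).transpose).det = X.numSpanningTrees := by
  classical
  rw [Matrix.det_mul_eq_sum_powersetCard]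
  have hS : ∀ S ∈ Finset.powersetCard (Fintype.card V) (Finset.univ : Finset (Option E)),
      ((X.rootedIncidence r).submatrix id (Subtype.val : {x // x ∈ S} → Option E) *
        (X.rootedIncidence r).transpose.submatrix (Subtype.val : {x // x ∈ S} → Option E) id).det =
      if none ∈ S ∧ (X.spanned {e | some e ∈ S}).Connected then 1 else 0 := by
    intro S hS
    have hcard := (Finset.mem_powersetCard.1 hS).2
    -- Indexing the columns by `V` makes the minor square, so that its Gram determinant is `det M ^
    -- 2`.
    let c : V ≃ {x // x ∈ S} := Fintype.equivOfCardEq (by simp [hcard])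
    set M := (X.rootedIncidence r).submatrix id (fun x => (c x : Option E)) with hM
    have hrange : ∀ o, o ∈ Set.range (fun x => (c x : Option E)) ↔ o ∈ S := fun o =>
      ⟨by rintro ⟨x, rfl⟩; exact (c x).2, fun h => ⟨c.symm ⟨o, h⟩, by simp⟩⟩
    have h1 : (X.rootedIncidence r).submatrix id (Subtype.val : {x // x ∈ S} → Option E) *
        (X.rootedIncidence r).transpose.submatrix (Subtype.val : {x // x ∈ S} → Option E) id =
        M * M.transpose := by
      ext x y
      simp only [Matrix.mul_apply, hM, Matrix.submatrix_apply, Matrix.transpose_apply, id]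
      exact (c.sum_comp fun o : {x // x ∈ S} =>
        X.rootedIncidence r x o * X.rootedIncidence r y o).symm
    rw [h1, Matrix.det_mul, Matrix.det_transpose]
    split_ifs with h
    · exact Int.isUnit_mul_self (det_rootedIncidence_of_connected X r _
        ((hrange none).2 h.1) (by simpa only [hrange] using h.2))
    · rw [det_rootedIncidence_of_not_connected X r _ (by simpa only [hrange] using h), mul_zero]
  rw [Finset.sum_congr rfl hS, Finset.sum_boole, numSpanningTrees, Nat.card_eq_fintype_card,
    Fintype.card_subtype, Nat.cast_inj]
  have hset : ∀ S : Finset (Option E), none ∈ S →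
      S.card = (S.eraseNone : Set E).ncard + 1 := by
    intro S h
    rw [Set.ncard_coe_finset, Finset.card_eraseNone_of_mem h]
    have := Finset.card_pos.2 ⟨_, h⟩
    omega
  have hset' : ∀ S : Finset (Option E), {e | some e ∈ S} = (S.eraseNone : Set E) := by
    intro S
    ext e
    simp
  refine Finset.card_bij' (fun S _ => (S.eraseNone : Set E))
    (fun T _ => Finset.insertNone T.toFinset) ?_ ?_ ?_ ?_
  · intro S h
    simp only [Finset.mem_filter, Finset.mem_powersetCard, Finset.subset_univ, true_and,
      Finset.mem_univ] at h ⊢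
    rw [isSpanningTree_iff, ← hset S h.2.1, Nat.card_eq_fintype_card, ← hset' S]
    exact ⟨h.2.2, h.1⟩
  · intro T h
    simp only [Finset.mem_filter, Finset.mem_powersetCard, Finset.subset_univ, true_and,
      Finset.mem_univ] at h ⊢
    rw [isSpanningTree_iff, Nat.card_eq_fintype_card] at h
    refine ⟨?_, by simp, ?_⟩
    · rw [hset _ (by simp), ← h.2]
      simp
    · rw [hset']
      simpa using h.1
  · intro S h
    have h := (Finset.mem_filter.1 h).2.1
    ext o
    cases o <;> simp [h]
  · intro T h
    simp

end MatrixTree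

end DiMultigraph

/-! ### Spanning trees of cyclic derived graphs -/

open Polynomial in
theorem Matrix.derivative_det {n R : Type*} [Fintype n] [DecidableEq n] [CommRing R]
    (M : Matrix n n R[X]) :
    derivative M.det = ∑ i, (M.updateCol i fun j => derivative (M j i)).det := by
  simp only [Matrix.det_apply', derivative_sum]
  rw [Finset.sum_comm]
  refine Finset.sum_congr rfl fun σ _ => ?_
  rw [derivative_intCast_mul, Polynomial.derivative_prod_finset, Finset.mul_sum]
  refine Finset.sum_congr rfl fun i _ => ?_
  rw [← Finset.prod_erase_mul _ _ (Finset.mem_univ i)]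
  simp only [Matrix.updateCol_self]
  congr 2
  refine Finset.prod_congr rfl fun j hj => ?_
  rw [Matrix.updateCol_ne (Finset.ne_of_mem_erase hj)]

-- The Laplacian is singular, so its determinant says nothing about spanning trees; the linear
-- coefficient of `det (X + L)` is a sum of principal cofactors, each of which counts them.
open Polynomial in
theorem Matrix.eval_zero_derivative_det_X_add {n R : Type*} [Fintype n] [DecidableEq n]
    [CommRing R] (A : Matrix n n R) :
    (derivative ((X : R[X]) • (1 : Matrix n n R[X]) + A.map C).det).eval 0 =
      A.adjugate.trace := by
  rw [Matrix.derivative_det, eval_finsetSum, Matrix.trace]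
  refine Finset.sum_congr rfl fun i _ => ?_
  rw [Matrix.diag_apply, ← Matrix.transpose_apply A.adjugate, Matrix.adjugate_transpose,
    Matrix.adjugate_apply, Matrix.updateRow_transpose, Matrix.det_transpose,
    ← Polynomial.coe_evalRingHom, RingHom.map_det]
  congr 1
  ext j k
  rcases eq_or_ne k i with rfl | hk
  · rcases eq_or_ne j k with rfl | hj
    · simp
    · simp [hj]
  · rcases eq_or_ne j k with rfl | hj
    · simp [hk]
    · simp [hk, hj]

namespace DiMultigraph

variable {V : Type u} {E : Type v}

section Laplacian

variable [DecidableEq V] [Fintype E] {R : Type*} [CommRing R]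

/-- The Laplacian of `X`, twisted by units attached to the edges. -/
def twistedLaplacian (X : DiMultigraph V E) (c : E → Rˣ) : Matrix V V R :=
  Matrix.of fun x y => ∑ e,
    ((Pi.single (X.src e) 1 : V → R) x - ((c e)⁻¹ : Rˣ) * (Pi.single (X.tgt e) 1 : V → R) x) *
    ((Pi.single (X.src e) 1 : V → R) y - (c e : R) * (Pi.single (X.tgt e) 1 : V → R) y)

theorem twistedLaplacian_apply (X : DiMultigraph V E) (c : E → Rˣ) (x y : V) :
    X.twistedLaplacian c x y = ∑ e,
    ((Pi.single (X.src e) 1 : V → R) x - ((c e)⁻¹ : Rˣ) * (Pi.single (X.tgt e) 1 : V → R) x) *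
    ((Pi.single (X.src e) 1 : V → R) y - (c e : R) * (Pi.single (X.tgt e) 1 : V → R) y) := rfl

theorem twistedLaplacian_map {S : Type*} [CommRing S] (X : DiMultigraph V E) (c : E → Rˣ)
    (φ : R →+* S) :
    (X.twistedLaplacian c).map φ = X.twistedLaplacian fun e => Units.map φ (c e) := by
  ext x y
  simp only [Matrix.map_apply, twistedLaplacian_apply, map_sum, map_mul, map_sub,
    Pi.single_apply, apply_ite φ, map_one, map_zero]
  rfl

theorem twistedLaplacian_one_map {S : Type*} [CommRing S] (X : DiMultigraph V E) (φ : R →+* S) :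
    (X.twistedLaplacian (1 : E → Rˣ)).map φ = X.twistedLaplacian (1 : E → Sˣ) := by
  rw [twistedLaplacian_map]
  congr
  funext e
  simp

theorem rootedIncidence_mul_transpose (X : DiMultigraph V E) (r : V) :
    X.rootedIncidence r * (X.rootedIncidence r).transpose =
      (X.twistedLaplacian (1 : E → ℤˣ)).updateRow r
        (X.twistedLaplacian (1 : E → ℤˣ) r + Pi.single r 1) := by
  ext x y
  rw [Matrix.mul_apply, Fintype.sum_option]
  have h : ∑ e, X.rootedIncidence r x (some e) * (X.rootedIncidence r).transpose (some e) y =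
      X.twistedLaplacian (1 : E → ℤˣ) x y := by
    simp [twistedLaplacian_apply, rootedIncidence]
  rw [h]
  rcases eq_or_ne x r with rfl | hx
  · simp [rootedIncidence, add_comm]
  · simp [rootedIncidence, hx]

variable [Fintype V]

theorem twistedLaplacian_mul_apply {B : Type*} (X : DiMultigraph V E) (c : E → Rˣ)
    (F : Matrix V B R) (x : V) (b : B) :
    (X.twistedLaplacian c * F) x b = ∑ e,
      ((Pi.single (X.src e) 1 : V → R) x - ((c e)⁻¹ : Rˣ) * (Pi.single (X.tgt e) 1 : V → R) x) *
      (F (X.src e) b - c e * F (X.tgt e) b) := by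
  simp only [Matrix.mul_apply, twistedLaplacian_apply, Finset.sum_mul]
  rw [Finset.sum_comm]
  refine Finset.sum_congr rfl fun e _ => ?_
  simp only [mul_assoc, ← Finset.mul_sum, sub_mul, Finset.sum_sub_distrib]
  simp [Pi.single_apply]

theorem det_twistedLaplacian_one [IsDomain R] [Nonempty V] (X : DiMultigraph V E) :
    (X.twistedLaplacian (1 : E → Rˣ)).det = 0 := by
  rw [← Matrix.exists_mulVec_eq_zero_iff]
  refine ⟨fun _ => 1, fun h => ?_, ?_⟩
  · simpa using congrFun h (Classical.arbitrary V)
  · ext x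
    simp only [Matrix.mulVec, dotProduct, mul_one, twistedLaplacian_apply, Pi.zero_apply]
    rw [Finset.sum_comm]
    refine Finset.sum_eq_zero fun e _ => ?_
    rw [← Finset.mul_sum]
    simp

/-- The matrix-tree theorem. -/
theorem adjugate_twistedLaplacian_one_apply_self (X : DiMultigraph V E) (r : V) :
    (X.twistedLaplacian (1 : E → ℤˣ)).adjugate r r = X.numSpanningTrees := by
  have : Nonempty V := ⟨r⟩
  -- Additivity in row `r` splits the determinant into `det L = 0` and the cofactor at `r`.
  rw [← det_rootedIncidence_mul_transpose X r, rootedIncidence_mul_transpose,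
    Matrix.det_updateRow_add, Matrix.updateRow_eq_self, det_twistedLaplacian_one, zero_add,
    Matrix.adjugate_apply]

theorem trace_adjugate_twistedLaplacian_one (X : DiMultigraph V E) :
    (X.twistedLaplacian (1 : E → Rˣ)).adjugate.trace =
      (Fintype.card V : R) * X.numSpanningTrees := by
  rw [← twistedLaplacian_one_map X (Int.castRingHom R), ← RingHom.mapMatrix_apply,
    ← RingHom.map_adjugate, RingHom.mapMatrix_apply, Matrix.trace]
  simp [adjugate_twistedLaplacian_one_apply_self]

theorem zpow_eq_of_intCast_eq {G : Type*} [Group G] {N : ℕ} {g : G} (hg : g ^ N = 1) {a b : ℤ}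
    (h : (a : ZMod N) = b) : g ^ a = g ^ b := by
  obtain ⟨c, hc⟩ := (ZMod.intCast_eq_intCast_iff_dvd_sub a b N).1 h
  rw [show b = a + N * c by linarith, zpow_add, zpow_mul]
  simp [hg]

/-- The character table is a Vandermonde matrix at the distinct powers of `ζ`. Nonvanishing suffices
for cancellation in a domain, so `N` need not be invertible. -/
theorem det_fourier_ne_zero [IsDomain R] {N : ℕ} [NeZero N] {ζ : Rˣ}
    (hζ : IsPrimitiveRoot (ζ : R) N) :
    (Matrix.of fun σ k : ZMod N => ((ζ ^ (k.val * σ.val) : Rˣ) : R)).det ≠ 0 := by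
  obtain ⟨n, rfl⟩ := Nat.exists_eq_succ_of_ne_zero (NeZero.ne N)
  rw [← Matrix.det_transpose]
  let e : Fin (n + 1) ≃ ZMod (n + 1) := (ZMod.finEquiv (n + 1)).toEquiv
  have h : (Matrix.of fun σ k : ZMod (n + 1) =>
      ((ζ ^ (k.val * σ.val) : Rˣ) : R)).transpose.submatrix e e =
      Matrix.vandermonde fun k : Fin (n + 1) => (ζ : R) ^ (k : ℕ) := by
    ext k σ
    simp only [Matrix.submatrix_apply, Matrix.transpose_apply, Matrix.of_apply,
      Matrix.vandermonde_apply, Units.val_pow_eq_pow_val, ← pow_mul]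
    rfl
  rw [← Matrix.det_submatrix_equiv_self e, h]
  rw [Matrix.det_vandermonde_ne_zero_iff]
  intro i j hij
  exact Fin.ext (hζ.pow_inj i.2 j.2 hij)

/-- The Laplacian of a derived graph with cyclic voltage group decomposes according to
characters. -/
theorem det_smul_one_add_twistedLaplacian_derived [IsDomain R] (X : DiMultigraph V E) {N : ℕ}
    [NeZero N] {ζ : Rˣ} (hζ : IsPrimitiveRoot (ζ : R) N) (α : E → ℤ) (t : R) :
    (t • (1 : Matrix (V × ZMod N) (V × ZMod N) R) +
      (X.derived (ZMod N) fun e => (α e : ZMod N)).twistedLaplacian (1 : E × ZMod N → Rˣ)).det =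
    ∏ k : ZMod N, (t • (1 : Matrix V V R) +
      X.twistedLaplacian fun e => ζ ^ ((k.val : ℤ) * α e)).det := by
  have hN : ζ ^ N = 1 := by
    ext
    simpa using hζ.pow_eq_one
  set Four := Matrix.of fun σ k : ZMod N => ((ζ ^ (k.val * σ.val) : Rˣ) : R) with hFour
  have four_add : ∀ σ k : ZMod N, ∀ a : ℤ,
      Four (σ + a) k = ((ζ ^ ((k.val : ℤ) * a) : Rˣ) : R) * Four σ k := by
    intro σ k a
    rw [hFour, Matrix.of_apply, Matrix.of_apply, ← Units.val_mul, ← zpow_natCast, ← zpow_natCast,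
      ← zpow_add]
    congr 1
    apply zpow_eq_of_intCast_eq hN
    push_cast
    simp
    ring
  have four_sub : ∀ σ k : ZMod N, ∀ a : ℤ,
      Four (σ - a) k = (((ζ ^ ((k.val : ℤ) * a))⁻¹ : Rˣ) : R) * Four σ k := by
    intro σ k a
    have := four_add σ k (-a)
    rw [Int.cast_neg, ← sub_eq_add_neg] at this
    rw [this, mul_neg, zpow_neg]
  -- The columns of `F` are the functions on the fibres given by characters; translating a fibre by
  -- `a` multiplies the `k`-th one by `ζ ^ (k a)`, which is the twist in the `k`-th block.
  set F := Matrix.kroneckerMap (· * ·) (1 : Matrix V V R) Four with hF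
  have hdet : F.det ≠ 0 := by
    rw [hF]
    rw [Matrix.det_kronecker, Matrix.det_one, one_pow, one_mul]
    exact pow_ne_zero _ (det_fourier_ne_zero hζ)
  have hLF : (X.derived (ZMod N) fun e => (α e : ZMod N)).twistedLaplacian
      (1 : E × ZMod N → Rˣ) * F = F * Matrix.blockDiagonal fun k : ZMod N =>
        X.twistedLaplacian fun e => ζ ^ ((k.val : ℤ) * α e) := by
    ext ⟨x, σ⟩ ⟨z, k⟩
    have hr : (F * Matrix.blockDiagonal fun k : ZMod N =>
        X.twistedLaplacian fun e => ζ ^ ((k.val : ℤ) * α e)) (x, σ) (z, k) =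
        Four σ k * X.twistedLaplacian (fun e => ζ ^ ((k.val : ℤ) * α e)) x z := by
      rw [Matrix.mul_apply, Finset.sum_eq_single (x, k)]
      · simp [hF, Matrix.blockDiagonal_apply]
      · rintro ⟨y, k'⟩ - hne
        rcases eq_or_ne x y with rfl | hxy
        · have : k' ≠ k := fun h => hne (by rw [h])
          simp [Matrix.blockDiagonal_apply, this]
        · simp [hF, hxy]
      · simp
    rw [hr, twistedLaplacian_mul_apply, twistedLaplacian_apply]
    simp only [Pi.one_apply, inv_one, Units.val_one, one_mul]
    rw [Fintype.sum_prod_type, Finset.mul_sum]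
    refine Finset.sum_congr rfl fun e _ => ?_
    simp only [derived, hF, Matrix.kroneckerMap_apply, four_add, sub_mul]
    have h1 : ∀ (y : V) (f : ZMod N → R) (a : ZMod N),
        ∑ ρ : ZMod N, (Pi.single (y, ρ + a) (1 : R) : V × ZMod N → R) (x, σ) * f ρ =
        (Pi.single y (1 : R) : V → R) x * f (σ - a) := by
      intro y f a
      rw [Finset.sum_eq_single (σ - a)]
      · simp [Pi.single_apply]
      · intro ρ _ hρ
        have : (x, σ) ≠ (y, ρ + a) := fun h => hρ (eq_sub_of_add_eq (Prod.ext_iff.1 h).2.symm)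
        simp [this]
      · simp
    have h2 := fun y f => h1 y f 0
    simp only [add_zero, sub_zero] at h2
    rw [Finset.sum_sub_distrib, h1 (X.tgt e) (fun ρ => (1 : Matrix V V R) (X.src e) z * Four ρ k -
      (1 : Matrix V V R) (X.tgt e) z * (((ζ ^ ((k.val : ℤ) * α e) : Rˣ) : R) * Four ρ k)),
      h2 (X.src e) (fun ρ => (1 : Matrix V V R) (X.src e) z * Four ρ k -
      (1 : Matrix V V R) (X.tgt e) z * (((ζ ^ ((k.val : ℤ) * α e) : Rˣ) : R) * Four ρ k)),
      four_sub]
    simp only [Matrix.one_apply, Pi.single_apply, eq_comm (a := z)]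
    ring
  have hmul : (t • (1 : Matrix (V × ZMod N) (V × ZMod N) R) +
      (X.derived (ZMod N) fun e => (α e : ZMod N)).twistedLaplacian (1 : E × ZMod N → Rˣ)) * F =
      F * Matrix.blockDiagonal fun k : ZMod N => (t • (1 : Matrix V V R) +
        X.twistedLaplacian fun e => ζ ^ ((k.val : ℤ) * α e)) := by
    have : (Matrix.blockDiagonal fun k : ZMod N => (t • (1 : Matrix V V R) +
        X.twistedLaplacian fun e => ζ ^ ((k.val : ℤ) * α e))) = t • 1 +
        Matrix.blockDiagonal fun k : ZMod N =>
          X.twistedLaplacian fun e => ζ ^ ((k.val : ℤ) * α e) := by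
      rw [← Matrix.blockDiagonal_one, ← Matrix.blockDiagonal_smul, ← Matrix.blockDiagonal_add]
      rfl
    rw [this, add_mul, mul_add, hLF]
    simp
  have := congrArg Matrix.det hmul
  rw [Matrix.det_mul, Matrix.det_mul, Matrix.det_blockDiagonal, mul_comm] at this
  exact mul_left_cancel₀ hdet this

open Polynomial in
/-- The number of spanning trees of a derived graph with cyclic voltage group. -/
theorem numSpanningTrees_derived [IsDomain R] [CharZero R] [Nonempty V] (X : DiMultigraph V E)
    {N : ℕ} [NeZero N] {ζ : Rˣ} (hζ : IsPrimitiveRoot (ζ : R) N) (α : E → ℤ) :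
    (N : R) * (X.derived (ZMod N) fun e => (α e : ZMod N)).numSpanningTrees =
      X.numSpanningTrees * ∏ k ∈ Finset.univ.erase (0 : ZMod N),
        (X.twistedLaplacian fun e => ζ ^ ((k.val : ℤ) * α e)).det := by
  have hζ' : IsPrimitiveRoot ((Units.map (C : R →+* R[X]).toMonoidHom ζ : R[X]ˣ) : R[X]) N :=
    hζ.map_of_injective (f := (C : R →+* R[X])) C_injective
  have key := det_smul_one_add_twistedLaplacian_derived X hζ' α Polynomial.X
  rw [← Finset.mul_prod_erase _ _ (Finset.mem_univ (0 : ZMod N))] at key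
  have hmap : ∀ k : ZMod N, (X.twistedLaplacian fun e =>
      (Units.map (C : R →+* R[X]).toMonoidHom ζ) ^ ((k.val : ℤ) * α e)) =
      (X.twistedLaplacian fun e => ζ ^ ((k.val : ℤ) * α e)).map C := by
    intro k
    rw [twistedLaplacian_map]
    congr
    funext e
    exact (map_zpow (Units.map (C : R →+* R[X]).toMonoidHom) ζ _).symm
  simp only [hmap] at key
  rw [← twistedLaplacian_one_map _ (C : R →+* R[X])] at key
  -- Compare linear coefficients. The factor of the trivial character vanishes at `0`, so the
  -- product rule leaves only the term in which that factor is differentiated.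
  have key := congrArg (fun q : R[X] => (derivative q).eval 0) key
  simp only [derivative_mul, eval_add, eval_mul, Matrix.eval_zero_derivative_det_X_add,
    trace_adjugate_twistedLaplacian_one, eval_prod] at key
  have heval : ∀ M : Matrix V V R,
      eval 0 ((Polynomial.X : R[X]) • (1 : Matrix V V R[X]) + M.map C).det = M.det := by
    intro M
    rw [← Polynomial.coe_evalRingHom, RingHom.map_det]
    congr 1
    ext i j
    simp
  have hzero : (fun e => ζ ^ (((0 : ZMod N).val : ℤ) * α e)) = (1 : E → Rˣ) := by
    funext e
    simp
  simp only [heval] at key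
  rw [hzero, trace_adjugate_twistedLaplacian_one, det_twistedLaplacian_one, zero_mul, add_zero,
    Fintype.card_prod, ZMod.card] at key
  have hV : (Fintype.card V : R) ≠ 0 := Nat.cast_ne_zero.2 Fintype.card_ne_zero
  apply mul_left_cancel₀ hV
  push_cast at key
  linear_combination key

end Laplacian

end DiMultigraph

/-! ### Valuations of norms from prime-power cyclotomic rings -/

section CyclotomicNorm

open Polynomial

/-- The norm from the `n`-th cyclotomic ring to `ℤ` of the element given by a polynomial. -/
noncomputable def cyclotomicNorm (n : ℕ) (g : ℤ[X]) : ℤ := resultant (cyclotomic n ℤ) g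

theorem cyclotomicNorm_cast (n : ℕ) (g : ℤ[X]) [NeZero n] :
    (cyclotomicNorm n g : ℂ) = ∏ η ∈ primitiveRoots n ℂ, aeval η g := by
  have h : (cyclotomicNorm n g : ℂ) = resultant (cyclotomic n ℂ) (g.map (Int.castRingHom ℂ))
      (cyclotomic n ℂ).natDegree g.natDegree := by
    rw [natDegree_cyclotomic, ← natDegree_cyclotomic n ℤ, ← map_cyclotomic_int, resultant_map_map]
    rfl
  rw [h, resultant_eq_prod_eval _ _ _ natDegree_map_le (IsAlgClosed.splits _),
    (cyclotomic.monic n ℂ).leadingCoeff, one_pow, one_mul, cyclotomic.roots_eq_primitiveRoots_val]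
  simp only [aeval_def, eval_map]
  rfl

theorem cyclotomicNorm_mul (n : ℕ) [NeZero n] (f g : ℤ[X]) :
    cyclotomicNorm n (f * g) = cyclotomicNorm n f * cyclotomicNorm n g := by
  apply Int.cast_injective (α := ℂ)
  push_cast
  simp only [cyclotomicNorm_cast, map_mul, Finset.prod_mul_distrib]

theorem cyclotomicNorm_pow (n : ℕ) [NeZero n] (f : ℤ[X]) (k : ℕ) :
    cyclotomicNorm n (f ^ k) = cyclotomicNorm n f ^ k := by
  apply Int.cast_injective (α := ℂ)
  push_cast
  simp only [cyclotomicNorm_cast, map_pow, Finset.prod_pow]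

theorem cyclotomicNorm_C (n : ℕ) [NeZero n] (a : ℤ) :
    cyclotomicNorm n (C a) = a ^ n.totient := by
  apply Int.cast_injective (α := ℂ)
  push_cast
  rw [cyclotomicNorm_cast, ← Complex.card_primitiveRoots n]
  simp

theorem cyclotomicNorm_congr (n : ℕ) [NeZero n] {f g : ℤ[X]} (h : cyclotomic n ℤ ∣ f - g) :
    cyclotomicNorm n f = cyclotomicNorm n g := by
  apply Int.cast_injective (α := ℂ)
  rw [cyclotomicNorm_cast, cyclotomicNorm_cast]
  refine Finset.prod_congr rfl fun η hη => ?_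
  obtain ⟨q, hq⟩ := h
  have h0 : aeval η (cyclotomic n ℤ) = 0 := by
    rw [aeval_def, ← eval_map, algebraMap_int_eq, map_cyclotomic_int]
    exact ((isRoot_cyclotomic_iff).2 ((mem_primitiveRoots (NeZero.pos n)).1 hη))
  have := congrArg (aeval η) hq
  rw [map_sub, map_mul, h0, zero_mul, sub_eq_zero] at this
  exact this

variable (p : ℕ) [hp : Fact p.Prime]

theorem cyclotomic_prime_pow_zmod (k : ℕ) :
    cyclotomic (p ^ (k + 1)) (ZMod p) = (X - C 1) ^ (p ^ (k + 1)).totient := by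
  have := cyclotomic_mul_prime_pow_eq (ZMod p) (p := p) (m := 1)
    (by simpa using hp.out.one_lt.ne') (Nat.succ_pos k)
  rw [mul_one, cyclotomic_one] at this
  rw [this, Nat.totient_prime_pow_succ hp.out, C_1, Nat.succ_sub_one, pow_succ, Nat.mul_sub,
    mul_one]

theorem exists_eq_C_mul_of_map_eq_zero {f : ℤ[X]} (h : f.map (Int.castRingHom (ZMod p)) = 0) :
    ∃ q, f = C (p : ℤ) * q := by
  refine (C_dvd_iff_dvd_coeff _ _).2 fun i => ?_
  have := congrArg (fun q => coeff q i) h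
  simpa [coeff_map, ZMod.intCast_zmod_eq_zero_iff_dvd] using this

/-- Modulo `p` the cyclotomic polynomial is a power of `X - 1`, so its resultant with `g` only sees
`g 1`. -/
theorem cyclotomicNorm_prime_pow_zmod (k : ℕ) (g : ℤ[X]) :
    (cyclotomicNorm (p ^ (k + 1)) g : ZMod p) =
      ((g.eval 1 : ℤ) : ZMod p) ^ (p ^ (k + 1)).totient := by
  have h : (cyclotomicNorm (p ^ (k + 1)) g : ZMod p) =
      resultant (cyclotomic (p ^ (k + 1)) (ZMod p)) (g.map (Int.castRingHom (ZMod p)))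
      (p ^ (k + 1)).totient g.natDegree := by
    rw [← map_cyclotomic_int, resultant_map_map, cyclotomicNorm, natDegree_cyclotomic]
    rfl
  rw [h, cyclotomic_prime_pow_zmod, resultant_X_sub_C_pow_left _ _ _ _ natDegree_map_le]
  congr 1
  rw [eval_map, ← map_one (Int.castRingHom (ZMod p)), eval₂_at_apply]
  rfl

theorem not_dvd_cyclotomicNorm {k : ℕ} {g : ℤ[X]} (h : ¬ (p : ℤ) ∣ g.eval 1) :
    ¬ (p : ℤ) ∣ cyclotomicNorm (p ^ (k + 1)) g := by
  rw [← ZMod.intCast_zmod_eq_zero_iff_dvd] at h ⊢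
  rw [cyclotomicNorm_prime_pow_zmod]
  exact pow_ne_zero _ h

theorem cyclotomicNorm_X_sub_one (k : ℕ) :
    cyclotomicNorm (p ^ (k + 1)) (X - C 1) = (-1) ^ (p ^ (k + 1)).totient * p := by
  rw [cyclotomicNorm, natDegree_X_sub_C, resultant_X_sub_C_right _ _ _ le_rfl,
    eval_one_cyclotomic_prime_pow, natDegree_cyclotomic]

/-- Write `Φ = (X - 1) ^ φ + p r`; evaluation at `1` gives `r 1 = 1`. Modulo `Φ` the term `p r q`
becomes `-(X - 1) ^ φ q`, so `r g` is congruent to `(X - 1) ^ l s`, where `s 1 = h 1` because `l <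
φ`. The norms of `r` and `s` are prime to `p`, and that of `X - 1` is `p` up to sign. -/
theorem padicValInt_cyclotomicNorm {g h q : ℤ[X]} {l : ℕ}
    (hg : g = (X - C 1) ^ l * h + C (p : ℤ) * q) (hh : ¬ (p : ℤ) ∣ h.eval 1) {k : ℕ}
    (hk : l < (p ^ (k + 1)).totient) :
    cyclotomicNorm (p ^ (k + 1)) g ≠ 0 ∧
      padicValInt p (cyclotomicNorm (p ^ (k + 1)) g) = l := by
  obtain ⟨r, hr⟩ : ∃ r, cyclotomic (p ^ (k + 1)) ℤ - (X - C 1) ^ (p ^ (k + 1)).totient =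
      C (p : ℤ) * r := by
    apply exists_eq_C_mul_of_map_eq_zero
    rw [Polynomial.map_sub, map_cyclotomic_int, cyclotomic_prime_pow_zmod]
    simp
  have hr1 : r.eval 1 = 1 := by
    have h1 := congrArg (eval 1) hr
    have h0 : (p ^ (k + 1)).totient ≠ 0 := by omega
    simp only [eval_sub, eval_one_cyclotomic_prime_pow, eval_pow, eval_X, eval_C, sub_self,
      zero_pow h0, sub_zero, eval_mul] at h1
    have hp0 : (p : ℤ) ≠ 0 := by exact_mod_cast hp.out.ne_zero
    exact mul_left_cancel₀ hp0 (by linarith)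
  set s := h * r - (X - C 1) ^ ((p ^ (k + 1)).totient - l) * q with hs
  have hs1 : ¬ (p : ℤ) ∣ s.eval 1 := by
    have : (p ^ (k + 1)).totient - l ≠ 0 := by omega
    simpa [hs, hr1, this] using hh
  have hmul : cyclotomicNorm (p ^ (k + 1)) r * cyclotomicNorm (p ^ (k + 1)) g =
      ((-1) ^ (p ^ (k + 1)).totient * p) ^ l * cyclotomicNorm (p ^ (k + 1)) s := by
    rw [← cyclotomicNorm_X_sub_one, ← cyclotomicNorm_pow, ← cyclotomicNorm_mul,
      ← cyclotomicNorm_mul]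
    refine cyclotomicNorm_congr _ ⟨q, ?_⟩
    have hpow : (X - C 1 : ℤ[X]) ^ (p ^ (k + 1)).totient =
        (X - C 1) ^ l * (X - C 1) ^ ((p ^ (k + 1)).totient - l) := by
      rw [← pow_add]
      congr 1
      omega
    rw [hpow] at hr
    rw [hg, hs]
    linear_combination (-q) * hr
  have hr' := not_dvd_cyclotomicNorm p (k := k) (g := r) (by
    rw [hr1]
    exact fun h => hp.out.one_lt.ne' (by exact_mod_cast Int.eq_one_of_dvd_one (by positivity) h))
  have hs' := not_dvd_cyclotomicNorm p (k := k) hs1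
  have hne : ∀ {a : ℤ}, ¬ (p : ℤ) ∣ a → a ≠ 0 := fun h h0 => h (h0 ▸ dvd_zero _)
  have hp0 : (p : ℤ) ≠ 0 := by exact_mod_cast hp.out.ne_zero
  have hleft : ((-1) ^ (p ^ (k + 1)).totient * (p : ℤ)) ^ l ≠ 0 :=
    pow_ne_zero _ (mul_ne_zero (pow_ne_zero _ (by norm_num)) hp0)
  have hg0 : cyclotomicNorm (p ^ (k + 1)) g ≠ 0 := fun h0 => by
    rw [h0, mul_zero] at hmul
    exact mul_ne_zero hleft (hne hs') hmul.symm
  refine ⟨hg0, ?_⟩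
  have hval := congrArg (padicValInt p) hmul
  rw [padicValInt.mul (hne hr') hg0, padicValInt.mul hleft (hne hs'),
    padicValInt.eq_zero_of_not_dvd hr', padicValInt.eq_zero_of_not_dvd hs'] at hval
  rw [zero_add, add_zero] at hval
  rw [hval, padicValInt, Int.natAbs_pow, Int.natAbs_mul, Int.natAbs_pow]
  simp

theorem exists_eq_X_sub_one_pow_mul_add {g : ℤ[X]} (hg : g.map (Int.castRingHom (ZMod p)) ≠ 0) :
    ∃ (l : ℕ) (h q : ℤ[X]), g = (X - C 1) ^ l * h + C (p : ℤ) * q ∧ ¬ (p : ℤ) ∣ h.eval 1 := by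
  obtain ⟨h', h1, h2⟩ := exists_eq_pow_rootMultiplicity_mul_and_not_dvd _ hg 1
  obtain ⟨h, rfl⟩ := map_surjective (Int.castRingHom (ZMod p)) (ZMod.ringHom_surjective _) h'
  set l := rootMultiplicity 1 (g.map (Int.castRingHom (ZMod p)))
  obtain ⟨q, hq⟩ := exists_eq_C_mul_of_map_eq_zero p (f := g - (X - C 1) ^ l * h) (by
    rw [Polynomial.map_sub, h1]
    simp)
  refine ⟨l, h, q, by rw [← hq]; ring, fun hd => h2 ?_⟩
  rw [dvd_iff_isRoot, IsRoot, eval_map, ← map_one (Int.castRingHom (ZMod p)), eval₂_at_apply]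
  exact (ZMod.intCast_zmod_eq_zero_iff_dvd _ _).2 hd

theorem exists_padicValInt_cyclotomicNorm_eq {P : ℤ[X]} (hP : P ≠ 0) :
    ∃ μ l k₀ : ℕ, (μ = 0 ↔ P.map (Int.castRingHom (ZMod p)) ≠ 0) ∧ ∀ k, k₀ ≤ k →
      padicValInt p (cyclotomicNorm (p ^ (k + 1)) P) = μ * (p ^ (k + 1)).totient + l := by
  have hprime : Prime (C (p : ℤ)) := prime_C_iff.2 (Nat.prime_iff_prime_int.1 hp.out)
  obtain ⟨g, hPg, hg⟩ :=
    (FiniteMultiplicity.of_not_isUnit hprime.not_isUnit hP).exists_eq_pow_mul_and_not_dvd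
  set μ := multiplicity (C (p : ℤ)) P
  have hg' : g.map (Int.castRingHom (ZMod p)) ≠ 0 := fun h =>
    hg (exists_eq_C_mul_of_map_eq_zero p h)
  obtain ⟨l, h, q, hlq, hh⟩ := exists_eq_X_sub_one_pow_mul_add p hg'
  -- The threshold `l` works because `φ(p ^ (k + 1)) ≥ p ^ k > k ≥ l`.
  refine ⟨μ, l, l, ⟨fun h0 => ?_, fun h0 => ?_⟩, fun k hk => ?_⟩
  · rw [hPg, h0, pow_zero, one_mul]
    exact hg'
  · by_contra hμ
    apply h0
    rw [hPg, Polynomial.map_mul, Polynomial.map_pow, map_C]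
    simp [hμ]
  · have hlt : l < (p ^ (k + 1)).totient := by
      rw [Nat.totient_prime_pow_succ hp.out]
      have h1 := Nat.lt_pow_self hp.out.one_lt (n := k)
      have h2 := hp.out.two_le
      calc l < p ^ k := by omega
        _ ≤ p ^ k * (p - 1) := Nat.le_mul_of_pos_right _ (by omega)
    obtain ⟨h1, h2⟩ := padicValInt_cyclotomicNorm p hlq hh hlt
    have hp0 : (p : ℤ) ≠ 0 := by exact_mod_cast hp.out.ne_zero
    rw [hPg, cyclotomicNorm_mul, cyclotomicNorm_pow, cyclotomicNorm_C,
      padicValInt.mul (by positivity) h1, h2, ← pow_mul, padicValInt, Int.natAbs_pow, Int.natAbs_natCast,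
      padicValNat.prime_pow, mul_comm]

end CyclotomicNorm

section PrimePowerRoots

variable (p : ℕ) [hp : Fact p.Prime]

theorem prod_erase_zero_eq_prod_primitiveRoots {ζ : ℂ} {m : ℕ} (hζ : IsPrimitiveRoot ζ (p ^ m))
    (G : ℂ → ℂ) :
    ∏ k ∈ Finset.univ.erase (0 : ZMod (p ^ m)), G (ζ ^ k.val) =
      ∏ j ∈ Finset.range m, ∏ η ∈ primitiveRoots (p ^ (j + 1)) ℂ, G η := by
  classical
  -- Setting the value at `1` to `1` turns the product over nontrivial roots into one over all
  -- roots, which splits by exact order.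
  set G' : ℂ → ℂ := fun η => if η = 1 then 1 else G η with hG'
  have hinj : ∀ k l : ZMod (p ^ m), ζ ^ k.val = ζ ^ l.val → k = l := fun k l h =>
    ZMod.val_injective _ (hζ.pow_inj k.val_lt l.val_lt h)
  have h1 : ∏ k ∈ Finset.univ.erase (0 : ZMod (p ^ m)), G (ζ ^ k.val) =
      ∏ k : ZMod (p ^ m), G' (ζ ^ k.val) := by
    rw [← Finset.mul_prod_erase _ _ (Finset.mem_univ (0 : ZMod (p ^ m)))]
    have : G' (ζ ^ (0 : ZMod (p ^ m)).val) = 1 := by simp [hG']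
    rw [this, one_mul]
    refine Finset.prod_congr rfl fun k hk => ?_
    rw [hG']
    dsimp only
    rw [if_neg]
    intro h
    exact Finset.ne_of_mem_erase hk (hinj k 0 (by simpa using h))
  have h2 : ∏ k : ZMod (p ^ m), G' (ζ ^ k.val) =
      ∏ η ∈ Polynomial.nthRootsFinset (p ^ m) (1 : ℂ), G' η := by
    refine Finset.prod_bij (fun k _ => ζ ^ k.val) ?_ ?_ ?_ ?_
    · intro k _
      rw [Polynomial.mem_nthRootsFinset (NeZero.pos _), ← pow_mul, mul_comm, pow_mul,
        hζ.pow_eq_one, one_pow]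
    · exact fun k _ l _ h => hinj k l h
    · intro η hη
      rw [Polynomial.mem_nthRootsFinset (NeZero.pos _)] at hη
      obtain ⟨i, hi, rfl⟩ := hζ.eq_pow_of_pow_eq_one hη
      exact ⟨i, Finset.mem_univ _, by rw [ZMod.val_natCast_of_lt hi]⟩
    · exact fun _ _ => rfl
  rw [h1, h2, IsPrimitiveRoot.nthRoots_one_eq_biUnion_primitiveRoots, Finset.prod_biUnion
    (fun a _ b _ h => IsPrimitiveRoot.disjoint h), Nat.prod_divisors_prime_pow hp.out,
    Finset.prod_range_succ']
  have : ∏ η ∈ primitiveRoots (p ^ 0) ℂ, G' η = 1 := by simp [hG']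
  rw [this, mul_one]
  refine Finset.prod_congr rfl fun j _ => Finset.prod_congr rfl fun η hη => ?_
  rw [hG']
  dsimp only
  rw [if_neg]
  rintro rfl
  have := (isPrimitiveRoot_of_mem_primitiveRoots hη).unique IsPrimitiveRoot.one
  exact (Nat.one_lt_pow (Nat.succ_ne_zero j) hp.out.one_lt).ne' this

end PrimePowerRoots

/-! ### The characteristic Laurent polynomial and the growth formula -/

namespace DiMultigraph

variable {V : Type u} {E : Type v} [DecidableEq V] [Fintype V] [Fintype E]

open LaurentPolynomial

/-- The variable of the ring of Laurent polynomials, as a unit. -/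
noncomputable def laurentVar (R : Type*) [CommRing R] : (R[T;T⁻¹])ˣ := (isUnit_T 1).unit

/-- The characteristic Laurent polynomial of an integral voltage assignment. -/
noncomputable def voltageDet (X : DiMultigraph V E) (α : E → ℤ) (R : Type*) [CommRing R] :
    R[T;T⁻¹] :=
  (X.twistedLaplacian fun e => laurentVar R ^ α e).det

theorem voltageDet_map (X : DiMultigraph V E) (α : E → ℤ) {R S : Type*} [CommRing R] [CommRing S]
    (φ : R[T;T⁻¹] →+* S) :
    φ (X.voltageDet α R) =
      (X.twistedLaplacian fun e => Units.map φ.toMonoidHom (laurentVar R) ^ α e).det := by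
  rw [voltageDet, RingHom.map_det, RingHom.mapMatrix_apply, twistedLaplacian_map]
  congr
  funext e
  exact map_zpow (Units.map φ.toMonoidHom) _ _

theorem unitsMap_eval₂_laurentVar {R S : Type*} [CommRing R] [CommRing S] (f : R →+* S) (x : Sˣ) :
    Units.map (eval₂ f x).toMonoidHom (laurentVar R) = x := by
  ext
  change eval₂ f x (T 1) = x
  rw [eval₂_T, zpow_one]

theorem eval₂_voltageDet (X : DiMultigraph V E) (α : E → ℤ) {R S : Type*} [CommRing R]
    [CommRing S] (f : R →+* S) (x : Sˣ) :
    eval₂ f x (X.voltageDet α R) = (X.twistedLaplacian fun e => x ^ α e).det := by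
  rw [voltageDet_map, unitsMap_eval₂_laurentVar]

theorem eval₂_C_comp_laurentVar_pow {R S : Type*} [CommRing R] [CommRing S] (f : R →+* S)
    (P : Polynomial R) (q : ℕ) :
    P.eval₂ ((C : S →+* S[T;T⁻¹]).comp f) ((laurentVar S ^ q : (S[T;T⁻¹])ˣ) : S[T;T⁻¹]) =
      (Polynomial.expand S q (P.map f)).toLaurent := by
  have hT : ((laurentVar S : (S[T;T⁻¹])ˣ) : S[T;T⁻¹]) = T 1 := rfl
  induction P using Polynomial.induction_on' with
  | add P Q hP hQ => simp only [Polynomial.eval₂_add, hP, hQ, Polynomial.map_add, map_add]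
  | monomial n a =>
    rw [Polynomial.eval₂_monomial, Polynomial.map_monomial, Polynomial.expand_monomial,
      Polynomial.toLaurent_C_mul_T]
    rw [Units.val_pow_eq_pow_val, hT, T_pow, T_pow]
    rw [RingHom.comp_apply, mul_one, Nat.cast_mul]

/-- After clearing denominators, the substitution `T ↦ T ^ q` is `Polynomial.expand`, which is
injective; powers of `T` are units. -/
theorem det_twistedLaplacian_laurentVar_pow_eq_zero (X : DiMultigraph V E) (α : E → ℤ)
    {R : Type*} [CommRing R] {q : ℕ} (hq : 0 < q) :
    (X.twistedLaplacian fun e => (laurentVar R ^ q) ^ α e).det = 0 ↔ X.voltageDet α R = 0 := by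
  obtain ⟨n, P, hP⟩ := exists_T_pow (X.voltageDet α R)
  have h := congrArg (eval₂ (C : R →+* R[T;T⁻¹]) (laurentVar R ^ q)) hP
  have h1 := eval₂_C_comp_laurentVar_pow (RingHom.id R) P q
  rw [RingHom.comp_id, Polynomial.map_id] at h1
  rw [map_mul, eval₂_voltageDet, eval₂_toLaurent, eval₂_T, h1] at h
  rw [← Units.mul_left_eq_zero ((laurentVar R ^ q) ^ (n : ℤ)), ← h, Polynomial.toLaurent_eq_zero,
    Polynomial.expand_eq_zero hq, ← Polynomial.toLaurent_eq_zero, hP]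
  exact Units.mul_left_eq_zero (isUnit_T (n : ℤ)).unit

variable (p : ℕ) [hp : Fact p.Prime]

theorem map_zmod_ne_zero_iff_voltageDet (X : DiMultigraph V E) (α : E → ℤ) {n : ℕ}
    {P : Polynomial ℤ} (hP : P.toLaurent = X.voltageDet α ℤ * T n) :
    P.map (Int.castRingHom (ZMod p)) ≠ 0 ↔ X.voltageDet α (ZMod p) ≠ 0 := by
  have h := congrArg (eval₂ ((C : ZMod p →+* (ZMod p)[T;T⁻¹]).comp (Int.castRingHom (ZMod p)))
    (laurentVar (ZMod p))) hP
  rw [map_mul, eval₂_voltageDet, eval₂_toLaurent, eval₂_T] at h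
  have h1 := eval₂_C_comp_laurentVar_pow (Int.castRingHom (ZMod p)) P 1
  rw [pow_one, Polynomial.expand_one] at h1
  rw [h1] at h
  rw [← Polynomial.toLaurent_ne_zero, h, ne_eq, Units.mul_left_eq_zero]
  rfl

/-- An integral form of the product over characters. The norms of `X ^ n` on the left compensate for
the denominator `T ^ n`; they are prime to `p`. -/
theorem numSpanningTrees_derived_prime_pow [Nonempty V] (X : DiMultigraph V E)
    (α : E → ℤ) {n : ℕ} {P : Polynomial ℤ} (hP : P.toLaurent = X.voltageDet α ℤ * T n) (m : ℕ) :
    (p : ℤ) ^ m * (X.derived (ZMod (p ^ m)) fun e => (α e : ZMod (p ^ m))).numSpanningTrees *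
      (∏ j ∈ Finset.range m, cyclotomicNorm (p ^ (j + 1)) (Polynomial.X ^ n)) =
    X.numSpanningTrees * ∏ j ∈ Finset.range m, cyclotomicNorm (p ^ (j + 1)) P := by
  apply Int.cast_injective (α := ℂ)
  have hζ := Complex.isPrimitiveRoot_exp (p ^ m) (NeZero.ne _)
  obtain ⟨ζ, hζu⟩ := hζ.isUnit (NeZero.ne _)
  rw [← hζu] at hζ
  have key := numSpanningTrees_derived X hζ α
  have hprod : ∀ Q : Polynomial ℤ, ((∏ j ∈ Finset.range m, cyclotomicNorm (p ^ (j + 1)) Q : ℤ) : ℂ)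
      = ∏ k ∈ Finset.univ.erase (0 : ZMod (p ^ m)), Polynomial.aeval ((ζ : ℂ) ^ k.val) Q := by
    intro Q
    rw [prod_erase_zero_eq_prod_primitiveRoots p hζ fun η => Polynomial.aeval η Q]
    push_cast
    exact Finset.prod_congr rfl fun j _ => cyclotomicNorm_cast _ _
  have hfactor : ∀ k : ZMod (p ^ m), Polynomial.aeval ((ζ : ℂ) ^ k.val) P =
      (X.twistedLaplacian fun e => ζ ^ ((k.val : ℤ) * α e)).det *
        Polynomial.aeval ((ζ : ℂ) ^ k.val) (Polynomial.X ^ n : Polynomial ℤ) := by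
    intro k
    have h := congrArg (eval₂ (Int.castRingHom ℂ) (ζ ^ k.val)) hP
    rw [map_mul, eval₂_voltageDet, eval₂_toLaurent, eval₂_T_n] at h
    simp only [zpow_mul, zpow_natCast, map_pow, Polynomial.aeval_X]
    rw [← Units.val_pow_eq_pow_val, ← h]
    rfl
  have h2 := hprod (Polynomial.X ^ n)
  have h3 := hprod P
  simp only [hfactor, Finset.prod_mul_distrib] at h3
  rw [← h2] at h3
  push_cast at key h3 ⊢
  rw [h3, ← mul_assoc, ← key]

/-- The analogue of Iwasawa's theorem for the numbers of spanning trees in a tower of derived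
graphs. -/
theorem exists_padicValNat_numSpanningTrees_derived [Nonempty V] (X : DiMultigraph V E)
    (α : E → ℤ)
    (hne : ∀ m, (X.derived (ZMod (p ^ m)) fun e => (α e : ZMod (p ^ m))).numSpanningTrees ≠ 0) :
    ∃ μ : ℕ, (μ = 0 ↔ X.voltageDet α (ZMod p) ≠ 0) ∧ ∃ lam ν : ℤ, ∀ᶠ m : ℕ in Filter.atTop,
      (padicValNat p
        (X.derived (ZMod (p ^ m)) fun e => (α e : ZMod (p ^ m))).numSpanningTrees : ℤ) =
        μ * (p : ℤ) ^ m + lam * (m : ℤ) + ν := by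
  obtain ⟨n, P, hP⟩ := exists_T_pow (X.voltageDet α ℤ)
  have hp0 : (p : ℤ) ≠ 0 := by exact_mod_cast hp.out.ne_zero
  have hXn : ∀ j, ¬ (p : ℤ) ∣ cyclotomicNorm (p ^ (j + 1)) (Polynomial.X ^ n) := fun j =>
    not_dvd_cyclotomicNorm p (by
      rw [Polynomial.eval_pow, Polynomial.eval_X, one_pow]
      exact fun h => hp.out.one_lt.ne' (by
        exact_mod_cast Int.eq_one_of_dvd_one (by positivity) h))
  have hXprod : ∀ m, (∏ j ∈ Finset.range m,
      cyclotomicNorm (p ^ (j + 1)) (Polynomial.X ^ n)) ≠ 0 ∧ padicValInt p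
        (∏ j ∈ Finset.range m, cyclotomicNorm (p ^ (j + 1)) (Polynomial.X ^ n)) = 0 := by
    intro m
    have : ¬ (p : ℤ) ∣ ∏ j ∈ Finset.range m,
        cyclotomicNorm (p ^ (j + 1)) (Polynomial.X ^ n) := by
      rw [Prime.dvd_finsetProd_iff (Nat.prime_iff_prime_int.1 hp.out)]
      rintro ⟨j, -, hj⟩
      exact hXn j hj
    exact ⟨fun h0 => this (h0 ▸ dvd_zero _), padicValInt.eq_zero_of_not_dvd this⟩
  -- The product formula transfers the nonvanishing of the tree counts to all the norms, and so to
  -- `P`.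
  have hne0 : ∀ m, (X.numSpanningTrees : ℤ) *
      ∏ j ∈ Finset.range m, cyclotomicNorm (p ^ (j + 1)) P ≠ 0 := by
    intro m
    rw [← numSpanningTrees_derived_prime_pow p X α hP m]
    exact mul_ne_zero (mul_ne_zero (pow_ne_zero _ hp0) (by exact_mod_cast hne m)) (hXprod m).1
  have hX0 : (X.numSpanningTrees : ℤ) ≠ 0 := left_ne_zero_of_mul (hne0 0)
  have hPprod := fun m => right_ne_zero_of_mul (hne0 m)
  have hP0 : P ≠ 0 := by
    rintro rfl
    have h := hPprod 1
    rw [Finset.prod_range_one, ← Polynomial.C_0, cyclotomicNorm_C, zero_pow] at h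
    · exact h rfl
    · exact (Nat.totient_pos.2 (NeZero.pos _)).ne'
  obtain ⟨μ, l, k₀, hμ, hval⟩ := exists_padicValInt_cyclotomicNorm_eq p hP0
  -- The `- 1` in the slope comes from the factor `p ^ m` of the product formula.
  refine ⟨μ, hμ.trans (map_zmod_ne_zero_iff_voltageDet p X α hP), (l : ℤ) - 1, ?_⟩
  let b : ℕ → ℤ := fun m =>
    (padicValInt p (∏ j ∈ Finset.range m, cyclotomicNorm (p ^ (j + 1)) P) : ℤ)
  have hb : ∀ m, k₀ ≤ m → b m = b k₀ + μ * ((p : ℤ) ^ m - (p : ℤ) ^ k₀) + l * ((m : ℤ) - k₀) := by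
    intro m hm
    induction m, hm using Nat.le_induction with
    | base => ring
    | succ m hm ih =>
      -- As `φ(p ^ (m + 1)) = p ^ (m + 1) - p ^ m`, the increments telescope.
      have hstep : b (m + 1) = b m + (μ * ((p : ℤ) ^ (m + 1) - (p : ℤ) ^ m) + l) := by
        have h1 := hPprod (m + 1)
        dsimp only [b]
        rw [Finset.prod_range_succ] at h1 ⊢
        rw [padicValInt.mul (left_ne_zero_of_mul h1) (right_ne_zero_of_mul h1), hval m hm,
          Nat.totient_prime_pow_succ hp.out]
        push_cast [Nat.cast_sub hp.out.one_le]
        ring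
      rw [hstep, ih]
      push_cast
      ring
  refine ⟨padicValNat p X.numSpanningTrees + b k₀ - μ * (p : ℤ) ^ k₀ - l * k₀, ?_⟩
  filter_upwards [Filter.eventually_ge_atTop k₀] with m hm
  have h := congrArg (padicValInt p) (numSpanningTrees_derived_prime_pow p X α hP m)
  have hm0 : ((X.derived (ZMod (p ^ m)) fun e => (α e : ZMod (p ^ m))).numSpanningTrees : ℤ) ≠ 0 :=
    by exact_mod_cast hne m
  rw [padicValInt.mul (mul_ne_zero (pow_ne_zero _ hp0) hm0) (hXprod m).1, (hXprod m).2,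
    padicValInt.mul (pow_ne_zero _ hp0) hm0, padicValInt.mul hX0 (hPprod m), padicValInt.of_nat,
    padicValInt.of_nat, ← Nat.cast_pow, padicValInt.of_nat, padicValNat.prime_pow] at h
  have h' := hb m hm
  have h'' : (m : ℤ) + padicValNat p
      (X.derived (ZMod (p ^ m)) fun e => (α e : ZMod (p ^ m))).numSpanningTrees =
      padicValNat p X.numSpanningTrees + b m := by
    dsimp only [b]
    exact_mod_cast h
  linarith

end DiMultigraph

/-! ### Connectivity, potentials and the integral cover -/

namespace DiMultigraph

variable {V : Type u} {E : Type v}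

section Connectivity

theorem toSimpleGraph_adj {X : DiMultigraph V E} {x y : V} :
    X.toSimpleGraph.Adj x y ↔ x ≠ y ∧
      ((∃ e, X.src e = x ∧ X.tgt e = y) ∨ ∃ e, X.src e = y ∧ X.tgt e = x) :=
  SimpleGraph.fromRel_adj _ _ _

theorem reachable_src_tgt (X : DiMultigraph V E) (e : E) :
    X.toSimpleGraph.Reachable (X.src e) (X.tgt e) := by
  by_cases h : X.src e = X.tgt e
  · rw [h]
  · exact (toSimpleGraph_adj.2 ⟨h, Or.inl ⟨e, rfl, rfl⟩⟩).reachable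

theorem apply_eq_of_reachable {X : DiMultigraph V E} {β : Type*} {f : V → β}
    (hf : ∀ e, f (X.src e) = f (X.tgt e)) {x y : V} (h : X.toSimpleGraph.Reachable x y) :
    f x = f y := by
  refine h.apply_eq fun x y hxy => ?_
  obtain ⟨-, ⟨e, rfl, rfl⟩ | ⟨e, rfl, rfl⟩⟩ := toSimpleGraph_adj.1 hxy
  · exact hf e
  · exact (hf e).symm

theorem reachable_map {V' E' : Type*} {X : DiMultigraph V E} {Y : DiMultigraph V' E'} {f : V → V'}
    (hf : ∀ e, Y.toSimpleGraph.Reachable (f (X.src e)) (f (X.tgt e))) {x y : V}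
    (h : X.toSimpleGraph.Reachable x y) : Y.toSimpleGraph.Reachable (f x) (f y) :=
  SimpleGraph.ConnectedComponent.eq.1 <|
    apply_eq_of_reachable (f := fun z => Y.toSimpleGraph.connectedComponentMk (f z))
      (fun e => SimpleGraph.ConnectedComponent.eq.2 (hf e)) h

theorem numSpanningTrees_ne_zero [Finite E] {X : DiMultigraph V E} (hX : X.Connected) :
    X.numSpanningTrees ≠ 0 := by
  obtain ⟨T, hT, htree⟩ := SimpleGraph.Connected.exists_isTree_le hX
  have hex : ∀ s : T.edgeSet, ∃ e, X.ends e = s := by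
    rintro ⟨s, hs⟩
    induction s with
    | _ x y =>
      obtain ⟨-, ⟨e, rfl, rfl⟩ | ⟨e, rfl, rfl⟩⟩ := toSimpleGraph_adj.1 (hT hs)
      · exact ⟨e, rfl⟩
      · exact ⟨e, Sym2.eq_swap⟩
  choose f hf using hex
  have himage : X.ends '' Set.range f = T.edgeSet := by
    ext s
    constructor
    · rintro ⟨_, ⟨s, rfl⟩, rfl⟩
      rw [hf]
      exact s.2
    · exact fun hs => ⟨_, ⟨⟨s, hs⟩, rfl⟩, hf _⟩
  have : Nonempty {S : Set E // X.IsSpanningTree S} := by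
    refine ⟨Set.range f, ?_, ?_, ?_⟩
    · rintro _ ⟨s, rfl⟩
      rw [hf]
      exact T.not_isDiag_of_mem_edgeSet s.2
    · rintro _ ⟨s, rfl⟩ _ ⟨t, rfl⟩ h
      rw [hf, hf] at h
      rw [Subtype.ext h]
    · rw [himage, SimpleGraph.fromEdgeSet_edgeSet]
      exact htree
  exact Nat.card_pos.ne'

theorem IsSpanningTree.image [Finite V] [Finite E] {V' E' : Type*} {X : DiMultigraph V E}
    {Y : DiMultigraph V' E'} (f : V ≃ V') (g : E ≃ E') (hsrc : ∀ e, Y.src (g e) = f (X.src e))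
    (htgt : ∀ e, Y.tgt (g e) = f (X.tgt e)) {S : Set E} (hS : X.IsSpanningTree S) :
    Y.IsSpanningTree (g '' S) := by
  have : Finite V' := Finite.of_equiv _ f
  have : Finite E' := Finite.of_equiv _ g
  rw [isSpanningTree_iff] at hS ⊢
  rw [Set.ncard_image_of_injective _ g.injective, ← Nat.card_congr f]
  refine ⟨?_, hS.2⟩
  have e : X.spanned S ≃g Y.spanned (g '' S) :=
    { f with
      map_rel_iff' := by
        intro x y
        rw [spanned_adj, spanned_adj]
        simp only [Set.exists_mem_image, hsrc, htgt,
          EmbeddingLike.apply_eq_iff_eq, ne_eq] }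
  exact e.connected_iff.1 hS.1

theorem numSpanningTrees_congr [Finite V] [Finite E] {V' E' : Type*} {X : DiMultigraph V E}
    {Y : DiMultigraph V' E'} (f : V ≃ V') (g : E ≃ E') (hsrc : ∀ e, Y.src (g e) = f (X.src e))
    (htgt : ∀ e, Y.tgt (g e) = f (X.tgt e)) : X.numSpanningTrees = Y.numSpanningTrees := by
  have : Finite V' := Finite.of_equiv _ f
  have : Finite E' := Finite.of_equiv _ g
  refine Nat.card_congr
    { toFun := fun S => ⟨g '' S.1, S.2.image f g hsrc htgt⟩
      invFun := fun S => ⟨g.symm '' S.1, S.2.image f.symm g.symm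
        (fun e => by rw [f.eq_symm_apply, ← hsrc]; simp)
        (fun e => by rw [f.eq_symm_apply, ← htgt]; simp)⟩
      left_inv := fun S => by simp [Set.image_image]
      right_inv := fun S => by simp [Set.image_image] }

end Connectivity

section Potential

/-- The derived graph of the constant voltage assignment with value `1 : ℤ`. -/
def integralCover (X : DiMultigraph V E) : DiMultigraph (V × ℤ) (E × ℤ) :=
  X.derived ℤ fun _ => 1

theorem integralCover_reachable_edge (X : DiMultigraph V E) (e : E) (s : ℤ) :
    X.integralCover.toSimpleGraph.Reachable (X.src e, s) (X.tgt e, s + 1) :=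
  X.integralCover.reachable_src_tgt (e, s)

theorem integralCover_reachable_add {X : DiMultigraph V E} {x y : V} {s t : ℤ}
    (h : X.integralCover.toSimpleGraph.Reachable (x, s) (y, t)) (c : ℤ) :
    X.integralCover.toSimpleGraph.Reachable (x, s + c) (y, t + c) := by
  refine reachable_map (f := fun z : V × ℤ => (z.1, z.2 + c)) (fun e => ?_) h
  have := integralCover_reachable_edge X e.1 (e.2 + c)
  rwa [add_right_comm] at this

theorem integralCover_reachable_of_isPath {X : DiMultigraph V E} {x y : V} {l : List (E ⊕ E)}
    (h : X.double.IsPath x y l) (s : ℤ) :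
    X.integralCover.toSimpleGraph.Reachable (x, s) (y, s + pathWeight l) := by
  induction l generalizing x s with
  | nil =>
    obtain rfl : x = y := h
    simp [pathWeight]
  | cons e l ih =>
    obtain ⟨rfl, h⟩ := h
    rcases e with e | e
    · have h1 := integralCover_reachable_edge X e s
      have h2 := ih h (s + 1)
      have : s + pathWeight (Sum.inl e :: l) = s + 1 + pathWeight l := by
        simp [pathWeight, add_assoc]
      rw [this]
      exact h1.trans h2
    · have h1 := (integralCover_reachable_edge X e (s - 1)).symm
      have h2 := ih h (s - 1)
      have : s + pathWeight (Sum.inr e :: l) = s - 1 + pathWeight l := by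
        simp [pathWeight, add_assoc, sub_eq_add_neg]
      rw [this]
      rw [sub_add_cancel] at h1
      exact h1.trans h2

/-- `h` is a potential for the constant voltage `1` modulo `d`, and `d` generates the group of
weights of closed paths. -/
structure IsPotential (X : DiMultigraph V E) (h : V → ℤ) (d : ℤ) : Prop where
  ne_zero : d ≠ 0
  reachable_iff : ∀ x y s t, X.integralCover.toSimpleGraph.Reachable (x, s) (y, t) ↔
    d ∣ (s - h x) - (t - h y)

/-- The heights reached over a base vertex `x₀` form a subgroup of `ℤ`, since the cover is invariant
under translation; `d` generates it, and `h x` is the height of some path from `x₀` to `x`. The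
cycle of nonzero weight excludes `d = 0`. -/
theorem exists_isPotential {X : DiMultigraph V E} (hconn : X.Connected)
    (hcycle : X.HasCycleOfNonzeroWeight) : ∃ h d, X.IsPotential h d := by
  obtain ⟨x₀⟩ := hconn.nonempty
  set G := X.integralCover.toSimpleGraph with hG
  have hex : ∀ x, ∃ s, G.Reachable (x₀, 0) (x, s) := by
    intro x
    have h := apply_eq_of_reachable (f := fun x => ∃ s, G.Reachable (x₀, 0) (x, s)) (fun e => ?_)
      (hconn.preconnected x₀ x)
    · exact h.mp ⟨0, SimpleGraph.Reachable.rfl⟩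
    · refine propext ⟨fun ⟨s, hs⟩ => ⟨s + 1, hs.trans (integralCover_reachable_edge X e s)⟩,
        fun ⟨s, hs⟩ => ⟨s - 1, hs.trans ?_⟩⟩
      have := (integralCover_reachable_edge X e (s - 1)).symm
      rwa [sub_add_cancel] at this
  choose h hh using hex
  let H : AddSubgroup ℤ :=
    { carrier := {w | G.Reachable (x₀, 0) (x₀, w)}
      zero_mem' := SimpleGraph.Reachable.rfl
      add_mem' := fun {a b} ha hb => by
        have := integralCover_reachable_add hb a
        rw [zero_add, add_comm] at this
        exact SimpleGraph.Reachable.trans ha this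
      neg_mem' := fun {a} ha => by
        have := integralCover_reachable_add ha (-a)
        rw [zero_add, add_neg_cancel] at this
        exact this.symm }
  obtain ⟨d, hd⟩ := Int.subgroup_cyclic H
  have hmem : ∀ w, G.Reachable (x₀, 0) (x₀, w) ↔ d ∣ w := by
    intro w
    change w ∈ H ↔ _
    rw [hd, ← AddSubgroup.zmultiples_eq_closure, Int.mem_zmultiples_iff]
  have hbase : ∀ x s, G.Reachable (x₀, s - h x) (x, s) := by
    intro x s
    have := integralCover_reachable_add (hh x) (s - h x)
    simpa using this
  have hiff : ∀ x y s t, G.Reachable (x, s) (y, t) ↔ d ∣ (s - h x) - (t - h y) := by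
    intro x y s t
    have h1 : G.Reachable (x, s) (y, t) ↔ G.Reachable (x₀, s - h x) (x₀, t - h y) :=
      ⟨fun h => (hbase x s).trans (h.trans (hbase y t).symm),
        fun h => (hbase x s).symm.trans (h.trans (hbase y t))⟩
    rw [h1, ← dvd_neg, neg_sub, ← hmem]
    constructor
    · intro hr
      have := integralCover_reachable_add hr (-(s - h x))
      simpa [sub_eq_add_neg] using this
    · intro hr
      have := integralCover_reachable_add hr (s - h x)
      simpa using this
  refine ⟨h, d, ?_, hiff⟩
  rintro rfl
  obtain ⟨x, l, hl, hw⟩ := hcycle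
  have := (hiff _ _ _ _).1 (integralCover_reachable_of_isPath hl 0)
  rw [zero_dvd_iff] at this
  exact hw (by linarith)

theorem IsPotential.dvd {X : DiMultigraph V E} {h : V → ℤ} {d : ℤ} (hX : X.IsPotential h d)
    (e : E) : d ∣ 1 + h (X.src e) - h (X.tgt e) := by
  have := (hX.reachable_iff _ _ _ _).1 (integralCover_reachable_edge X e 0)
  rw [← dvd_neg] at this
  have heq : 1 + h (X.src e) - h (X.tgt e) =
      -((0 - h (X.src e)) - (0 + 1 - h (X.tgt e))) := by ring
  rwa [heq]

/-- The voltage assignment of the connected tower over a component: the defect of the potential,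
divided by the `p`-part of the group of weights. -/
def reducedVoltage (X : DiMultigraph V E) (h : V → ℤ) (q : ℤ) (e : E) : ℤ :=
  (1 + h (X.src e) - h (X.tgt e)) / q

theorem IsPotential.mul_reducedVoltage {X : DiMultigraph V E} {h : V → ℤ} {d q : ℤ}
    (hX : X.IsPotential h d) (hq : q ∣ d) (e : E) :
    q * X.reducedVoltage h q e = 1 + h (X.src e) - h (X.tgt e) :=
  Int.mul_ediv_cancel' (hq.trans (hX.dvd e))

variable (p : ℕ) [hp : Fact p.Prime]

/-- Dividing the voltage by `q` leaves `d'` as generator of the closed-path weights, and `d'` is a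
unit modulo `p ^ m`. -/
theorem IsPotential.connected_derived [Nonempty V] {X : DiMultigraph V E} {h : V → ℤ} {q d' : ℤ}
    (hX : X.IsPotential h (q * d')) (hd' : IsCoprime d' p) (m : ℕ) :
    (X.derived (ZMod (p ^ m)) fun e => (X.reducedVoltage h q e : ZMod (p ^ m))).Connected := by
  have hq0 : q ≠ 0 := left_ne_zero_of_mul hX.ne_zero
  refine (SimpleGraph.connected_iff _).2 ⟨?_, inferInstance⟩
  rintro ⟨x, σ⟩ ⟨y, τ⟩
  obtain ⟨a, b, hab⟩ := hd'.pow_right (n := m)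
  set s : ℤ := (σ.val : ℤ) with hs
  -- By Bézout, `t` is congruent to `τ` modulo `p ^ m` and to `s` modulo `d'`, so the two lifts are
  -- joined in the integral cover.
  set t : ℤ := (τ.val : ℤ) + ((σ.val : ℤ) - (τ.val : ℤ)) * (b * p ^ m) with ht
  have hst : X.integralCover.toSimpleGraph.Reachable (x, q * s + h x) (y, q * t + h y) := by
    rw [hX.reachable_iff]
    refine ⟨(s - (τ.val : ℤ)) * a, ?_⟩
    rw [ht]
    linear_combination (- q * (s - (τ.val : ℤ))) * hab
  -- The rounding in the division by `q` is harmless: along an edge `z.2 - h z.1` changes by an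
  -- exact multiple of `q`.
  have hmap := reachable_map (Y := X.derived (ZMod (p ^ m)) fun e =>
    (X.reducedVoltage h q e : ZMod (p ^ m)))
    (f := fun z : V × ℤ => (z.1, (((z.2 - h z.1) / q : ℤ) : ZMod (p ^ m)))) (fun e => ?_) hst
  · simp only [add_sub_cancel_right, Int.mul_ediv_cancel_left _ hq0] at hmap
    convert hmap using 2
    · simp [s]
    · have : (p : ZMod (p ^ m)) ^ m = 0 := by
        rw [← Nat.cast_pow, ZMod.natCast_self]
      simp [ht, this]
  · have hedge := (X.derived (ZMod (p ^ m)) fun e =>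
      (X.reducedVoltage h q e : ZMod (p ^ m))).reachable_src_tgt
      (e.1, (((e.2 - h (X.src e.1)) / q : ℤ) : ZMod (p ^ m)))
    have key : (((e.2 + 1 - h (X.tgt e.1)) / q : ℤ) : ZMod (p ^ m)) =
        (((e.2 - h (X.src e.1)) / q : ℤ) : ZMod (p ^ m)) +
        (X.reducedVoltage h q e.1 : ZMod (p ^ m)) := by
      rw [← Int.cast_add, ← Int.add_mul_ediv_left _ _ hq0,
        hX.mul_reducedVoltage (dvd_mul_right _ _)]
      congr 2
      ring
    change (X.derived (ZMod (p ^ m)) fun e =>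
      (X.reducedVoltage h q e : ZMod (p ^ m))).toSimpleGraph.Reachable _
      (X.tgt e.1, (((e.2 + 1 - h (X.tgt e.1)) / q : ℤ) : ZMod (p ^ m)))
    rw [key]
    exact hedge

end Potential

end DiMultigraph

/-! ### Components of the layers and the towers above them -/

namespace DiMultigraph

variable {V : Type u} {E : Type v}

section Layers

variable (p : ℕ) [hp : Fact p.Prime]

/-- The invariant that separates the connected components of the layers. -/
noncomputable def layerClass (h : V → ℤ) (a : ℤ_[p]) {k n : ℕ} (hkn : k ≤ n)
    (z : V × ZMod (p ^ n)) : ZMod (p ^ k) :=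
  ZMod.castHom (pow_dvd_pow p hkn) (ZMod (p ^ k)) z.2 - PadicInt.toZModPow k a * (h z.1 : ZMod _)

variable {p} {X : DiMultigraph V E} {h : V → ℤ} {a : ℤ_[p]} {n₀ : ℕ} {d' : ℤ}

theorem castHom_toZModPow {k n : ℕ} (hkn : k ≤ n) (a : ℤ_[p]) :
    ZMod.castHom (pow_dvd_pow p hkn) (ZMod (p ^ k)) (PadicInt.toZModPow n a) =
      PadicInt.toZModPow k a :=
  PadicInt.cast_toZModPow k n hkn a

/-- In the coordinate `s` a step by `a` becomes a step by `1`, so the integral cover maps onto every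
layer, whatever the unit `a`. -/
theorem exists_eq_toZModPow_mul_intCast (ha : IsUnit a) (n : ℕ) (σ : ZMod (p ^ n)) :
    ∃ s : ℤ, σ = PadicInt.toZModPow n a * (s : ZMod (p ^ n)) := by
  obtain ⟨b, hb⟩ := (ha.map (PadicInt.toZModPow (p := p) n)).exists_right_inv
  obtain ⟨s, hs⟩ := ZMod.intCast_surjective (b * σ)
  exact ⟨s, by rw [hs, ← mul_assoc, hb, one_mul]⟩

/-- Reduction modulo `p ^ n` replaces the weight group `dℤ` by `dℤ + p ^ n ℤ = p ^ k ℤ`; the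
hypotheses on `k` amount to `k = min n n₀`. -/
theorem layer_reachable_iff (hX : X.IsPotential h ((p : ℤ) ^ n₀ * d')) (hd' : IsCoprime d' p)
    (ha : IsUnit a) {k n : ℕ} (hkn : k ≤ n) (hk : k ≤ n₀) (hkk : k = n ∨ k = n₀)
    {z w : V × ZMod (p ^ n)} :
    (X.layer p a n).toSimpleGraph.Reachable z w ↔
      layerClass p h a hkn z = layerClass p h a hkn w := by
  constructor
  · refine apply_eq_of_reachable fun e => ?_
    simp only [layer, derived, layerClass, map_add, castHom_toZModPow hkn]
    have hdvd : (p : ℤ) ^ k ∣ 1 + h (X.src e.1) - h (X.tgt e.1) :=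
      ((pow_dvd_pow _ hk).trans (dvd_mul_right _ _)).trans (hX.dvd e.1)
    have h0 : ((1 + h (X.src e.1) - h (X.tgt e.1) : ℤ) : ZMod (p ^ k)) = 0 :=
      (ZMod.intCast_zmod_eq_zero_iff_dvd _ _).2 (by exact_mod_cast hdvd)
    push_cast at h0
    linear_combination (-(PadicInt.toZModPow k a)) * h0
  · intro heq
    obtain ⟨x, σ⟩ := z
    obtain ⟨y, τ⟩ := w
    obtain ⟨s, rfl⟩ := exists_eq_toZModPow_mul_intCast ha n σ
    obtain ⟨t, rfl⟩ := exists_eq_toZModPow_mul_intCast ha n τ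
    have hdvd : (p : ℤ) ^ k ∣ (s - h x) - (t - h y) := by
      simp only [layerClass, map_mul, castHom_toZModPow hkn, map_intCast] at heq
      have h0 : (((s - h x) - (t - h y) : ℤ) : ZMod (p ^ k)) = 0 := by
        apply (ha.map (PadicInt.toZModPow (p := p) k)).mul_left_cancel
        push_cast
        linear_combination heq
      exact_mod_cast (ZMod.intCast_zmod_eq_zero_iff_dvd _ _).1 h0
    obtain ⟨c, hc⟩ := hdvd
    -- The `p ^ n` part of this combination is absorbed by moving `t` by a multiple of `p ^ n`,
    -- which the layer does not see.
    obtain ⟨b₁, b₂, hb⟩ : ∃ b₁ b₂ : ℤ, (p : ℤ) ^ k = (p : ℤ) ^ n₀ * d' * b₁ + (p : ℤ) ^ n * b₂ := by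
      rcases hkk with rfl | rfl
      · exact ⟨0, 1, by ring⟩
      · obtain ⟨b₁, b₂, hb⟩ := hd'.pow_right (n := n - k)
        refine ⟨b₁, b₂, ?_⟩
        have : (p : ℤ) ^ n = (p : ℤ) ^ k * (p : ℤ) ^ (n - k) := by
          rw [← pow_add]
          congr 1
          omega
        rw [this]
        linear_combination (-(p : ℤ) ^ k) * hb
    have hY : X.integralCover.toSimpleGraph.Reachable (x, s) (y, t + (p : ℤ) ^ n * (b₂ * c)) := by
      rw [hX.reachable_iff]
      refine ⟨b₁ * c, ?_⟩
      linear_combination hc + c * hb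
    have hmap := reachable_map (Y := X.layer p a n)
      (f := fun z : V × ℤ => (z.1, PadicInt.toZModPow n a * (z.2 : ZMod (p ^ n))))
      (fun e => ?_) hY
    · have hp0 : (p : ZMod (p ^ n)) ^ n = 0 := by
        rw [← Nat.cast_pow, ZMod.natCast_self]
      simpa [hp0] using hmap
    · have hedge := (X.layer p a n).reachable_src_tgt
        (e.1, PadicInt.toZModPow n a * (e.2 : ZMod (p ^ n)))
      have key : PadicInt.toZModPow n a * ((e.2 + 1 : ℤ) : ZMod (p ^ n)) =
          PadicInt.toZModPow n a * (e.2 : ZMod (p ^ n)) + PadicInt.toZModPow n a := by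
        push_cast
        ring
      change (X.layer p a n).toSimpleGraph.Reachable _
        (X.tgt e.1, PadicInt.toZModPow n a * ((e.2 + 1 : ℤ) : ZMod (p ^ n)))
      rw [key]
      exact hedge

theorem numComponents_eq [Nonempty V] (hX : X.IsPotential h ((p : ℤ) ^ n₀ * d'))
    (hd' : IsCoprime d' p) (ha : IsUnit a) (n : ℕ) :
    X.numComponents p a n = p ^ min n n₀ := by
  have hiff := fun z w => layer_reachable_iff hX hd' ha (min_le_left n n₀) (min_le_right n n₀)
    (min_choice n n₀) (z := z) (w := w)
  have hbij : Function.Bijective (SimpleGraph.ConnectedComponent.lift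
      (layerClass p h a (min_le_left n n₀))
      fun z w q _ => (hiff z w).1 q.reachable) := by
    constructor
    · intro c c'
      induction c using SimpleGraph.ConnectedComponent.ind with | _ z
      induction c' using SimpleGraph.ConnectedComponent.ind with | _ w
      exact fun hzw => SimpleGraph.ConnectedComponent.eq.2 ((hiff z w).2 hzw)
    · intro σ
      let x : V := Classical.arbitrary V
      obtain ⟨τ, hτ⟩ := ZMod.castHom_surjective (pow_dvd_pow p (min_le_left n n₀))
        (σ + PadicInt.toZModPow _ a * (h x : ZMod _))
      refine ⟨SimpleGraph.connectedComponentMk _ (x, τ), ?_⟩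
      change layerClass p h a (min_le_left n n₀) (x, τ) = σ
      simp only [layerClass, hτ, add_sub_cancel_right]
  rw [numComponents, Nat.card_eq_of_bijective _ hbij, Nat.card_zmod]

theorem isStableIndex [Nonempty V] (hX : X.IsPotential h ((p : ℤ) ^ n₀ * d'))
    (hd' : IsCoprime d' p) (ha : IsUnit a) : X.IsStableIndex p a n₀ := by
  have hnum := numComponents_eq hX hd' ha
  constructor
  · intro n hn
    rw [hnum, hnum, min_eq_right hn, min_self]
  · intro m hm
    by_contra! hlt
    have := hm n₀ hlt.le
    rw [hnum, hnum, min_self, min_eq_left hlt.le] at this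
    exact hlt.ne' (Nat.pow_right_injective hp.out.two_le this)

theorem pow_mul_intCast_eq_iff {m : ℕ} {y y' : ℤ} :
    ((p : ZMod (p ^ (n₀ + m))) ^ n₀ * (y : ZMod (p ^ (n₀ + m))) =
      (p : ZMod (p ^ (n₀ + m))) ^ n₀ * (y' : ZMod (p ^ (n₀ + m)))) ↔
      (y : ZMod (p ^ m)) = (y' : ZMod (p ^ m)) := by
  have hp0 : (p : ℤ) ^ n₀ ≠ 0 := pow_ne_zero _ (by exact_mod_cast hp.out.ne_zero)
  have h1 := ZMod.intCast_eq_intCast_iff_dvd_sub ((p : ℤ) ^ n₀ * y) ((p : ℤ) ^ n₀ * y')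
    (p ^ (n₀ + m))
  push_cast at h1
  rw [h1, ZMod.intCast_eq_intCast_iff_dvd_sub, ← mul_sub, pow_add,
    mul_dvd_mul_iff_left hp0]
  push_cast
  rfl

/-- The layers of the tower over a component of the stable layer are derived graphs
of `X` itself. -/
theorem numSpanningTrees_towerLayer [Finite V] [Finite E] [Nonempty V]
    (hX : X.IsPotential h ((p : ℤ) ^ n₀ * d'))
    (hd' : IsCoprime d' p) (ha : IsUnit a)
    (c : (X.layer p a n₀).toSimpleGraph.ConnectedComponent) (m : ℕ) :
    (X.towerLayer p a n₀ c m).numSpanningTrees =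
      (X.derived (ZMod (p ^ m)) fun e =>
        (X.reducedVoltage h ((p : ℤ) ^ n₀) e : ZMod (p ^ m))).numSpanningTrees := by
  induction c using SimpleGraph.ConnectedComponent.ind with | _ z₀
  obtain ⟨b, hb⟩ := exists_eq_toZModPow_mul_intCast ha n₀ (layerClass p h a le_rfl z₀)
  set A := PadicInt.toZModPow (p := p) (n₀ + m) a with hA
  have hAu : IsUnit A := ha.map (PadicInt.toZModPow (p := p) (n₀ + m))
  set W := X.verticesAbove p a n₀ (SimpleGraph.connectedComponentMk _ z₀) m with hW
  have hmemW : ∀ (x : V) (s : ℤ), (x, A * (s : ZMod (p ^ (n₀ + m)))) ∈ W ↔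
      (p : ℤ) ^ n₀ ∣ s - h x - b := by
    intro x s
    change (x, _) ∈ SimpleGraph.ConnectedComponent.supp _ ↔ _
    rw [SimpleGraph.ConnectedComponent.mem_supp_iff, SimpleGraph.ConnectedComponent.eq,
      layer_reachable_iff hX hd' ha le_rfl le_rfl (Or.inl rfl), hb]
    have h0 : ((s - h x - b : ℤ) : ZMod (p ^ n₀)) = 0 ↔ (p : ℤ) ^ n₀ ∣ s - h x - b := by
      rw [ZMod.intCast_zmod_eq_zero_iff_dvd]
      push_cast
      rfl
    rw [← h0, layerClass, ZMod.castHom_self, RingHom.id_apply]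
    simp only [map_mul, hA, castHom_toZModPow (Nat.le_add_right n₀ m), map_intCast]
    rw [← mul_sub, (ha.map (PadicInt.toZModPow (p := p) n₀)).mul_right_inj, ← sub_eq_zero]
    push_cast
    rfl
  -- By `hmemW`, the fibre coordinates over `x` in this component are `a s` with `s ≡ h x + b`
  -- modulo `p ^ n₀`; the quotient by `p ^ n₀` is the new coordinate `τ`. Adding `1` to `s` and
  -- passing from `h (src e)` to `h (tgt e)` adds the reduced voltage to `τ`.
  let lift : V → ZMod (p ^ m) → ZMod (p ^ (n₀ + m)) := fun x τ =>
    A * ((h x + b + (p : ℤ) ^ n₀ * (τ.val : ℤ) : ℤ) : ZMod (p ^ (n₀ + m)))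
  have hlift_mem : ∀ x τ, (x, lift x τ) ∈ W := fun x τ => (hmemW x _).2 ⟨τ.val, by ring⟩
  have hlift_int : ∀ x (y : ℤ), lift x (y : ZMod (p ^ m)) =
      A * ((h x + b + (p : ℤ) ^ n₀ * y : ℤ) : ZMod (p ^ (n₀ + m))) := by
    intro x y
    have := (pow_mul_intCast_eq_iff (p := p) (n₀ := n₀) (m := m)
      (y := (((y : ZMod (p ^ m)).val : ℕ) : ℤ)) (y' := y)).2 (by simp)
    simp only [lift]
    push_cast at this ⊢
    rw [this]
  have hlift_inj : ∀ x τ τ', lift x τ = lift x τ' → τ = τ' := by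
    intro x τ τ' heq
    have h1 := hAu.mul_left_cancel heq
    push_cast at h1
    have h2 := (pow_mul_intCast_eq_iff (p := p) (n₀ := n₀) (m := m)
      (y := (τ.val : ℤ)) (y' := (τ'.val : ℤ))).1 (by
        push_cast
        exact add_left_cancel h1)
    simpa using h2
  have hlift_surj : ∀ x σ, (x, σ) ∈ W → ∃ τ, lift x τ = σ := by
    intro x σ hσ
    obtain ⟨s, rfl⟩ := exists_eq_toZModPow_mul_intCast ha (n₀ + m) σ
    obtain ⟨y, hy⟩ := (hmemW x s).1 hσ
    refine ⟨y, ?_⟩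
    rw [hlift_int, ← hy]
    congr 2
    ring
  have hlift_edge : ∀ e τ, lift (X.src e) τ + A =
      lift (X.tgt e) (τ + (X.reducedVoltage h ((p : ℤ) ^ n₀) e : ZMod (p ^ m))) := by
    intro e τ
    obtain ⟨y, rfl⟩ := ZMod.intCast_surjective τ
    rw [← Int.cast_add, hlift_int, hlift_int]
    have h1 := hX.mul_reducedVoltage (dvd_mul_right _ _) e
    have h2 : h (X.tgt e) + b + (p : ℤ) ^ n₀ * (y + X.reducedVoltage h ((p : ℤ) ^ n₀) e) =
        (h (X.src e) + b + (p : ℤ) ^ n₀ * y) + 1 := by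
      linear_combination h1
    rw [h2, Int.cast_add _ 1, Int.cast_one, mul_add, mul_one]
  symm
  refine numSpanningTrees_congr
    (Equiv.ofBijective (fun z : V × ZMod (p ^ m) => (⟨(z.1, lift z.1 z.2), hlift_mem _ _⟩ : W))
      ⟨?_, ?_⟩)
    (Equiv.ofBijective (fun e : E × ZMod (p ^ m) =>
      (⟨(e.1, lift (X.src e.1) e.2), hlift_mem _ _, by
        change (X.tgt e.1, lift (X.src e.1) e.2 + A) ∈ W
        rw [hlift_edge]
        exact hlift_mem _ _⟩ : {e // (X.layer p a (n₀ + m)).src e ∈ W ∧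
          (X.layer p a (n₀ + m)).tgt e ∈ W})) ⟨?_, ?_⟩) (fun e => rfl) (fun e => ?_)
  · rintro ⟨x, τ⟩ ⟨x', τ'⟩ heq
    simp only [Subtype.mk.injEq, Prod.mk.injEq] at heq
    obtain ⟨rfl, heq⟩ := heq
    rw [hlift_inj _ _ _ heq]
  · rintro ⟨⟨x, σ⟩, hσ⟩
    obtain ⟨τ, rfl⟩ := hlift_surj x σ hσ
    exact ⟨(x, τ), rfl⟩
  · rintro ⟨e, τ⟩ ⟨e', τ'⟩ heq
    simp only [Subtype.mk.injEq, Prod.mk.injEq] at heq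
    obtain ⟨rfl, heq⟩ := heq
    rw [hlift_inj _ _ _ heq]
  · rintro ⟨⟨e, σ⟩, hσ, hσ'⟩
    obtain ⟨τ, rfl⟩ := hlift_surj (X.src e) σ hσ
    exact ⟨(e, τ), rfl⟩
  · refine Subtype.ext (Prod.ext rfl ?_)
    exact hlift_edge e.1 e.2

end Layers

end DiMultigraph

/-! ### Vanishing of the constant-voltage determinant modulo p -/

open Polynomial in
/-- For commuting matrices `A`, `B` over a field and a nonzero scalar `k`, the matrix polynomial
`k X - A X ^ 2 - B` is nonsingular. -/
theorem Matrix.det_quadratic_ne_zero_of_commute {n F : Type*} [Fintype n] [DecidableEq n] [Field F]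
    {A B : Matrix n n F} (hAB : Commute A B) {k : F} (hk : k ≠ 0) :
    ((C k * X : F[X]) • (1 : Matrix n n F[X]) - (X ^ 2 : F[X]) • A.map C - B.map C).det ≠ 0 := by
  set M := (C k * X : F[X]) • (1 : Matrix n n F[X]) - (X ^ 2 : F[X]) • A.map C - B.map C with hM
  have hMv : ∀ v : n → F[X], M.mulVec v =
      (C k * X : F[X]) • v - (X ^ 2 : F[X]) • (A.map C).mulVec v - (B.map C).mulVec v := by
    intro v
    rw [hM, Matrix.sub_mulVec, Matrix.sub_mulVec, Matrix.smul_mulVec, Matrix.smul_mulVec,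
      Matrix.one_mulVec]
  have hcoeff : ∀ (N : Matrix n n F) (v : n → F[X]) (x : n) (i : ℕ),
      (∀ y, (v y).coeff i = 0) → ((N.map C).mulVec v x).coeff i = 0 := by
    intro N v x i hv
    simp [Matrix.mulVec, dotProduct, hv]
  have hcomm : Commute M (A.map C) := by
    have hB : Commute (B.map C) (A.map C) := by
      have := congrArg (fun N : Matrix n n F => N.map (C : F →+* F[X])) hAB.eq.symm
      rw [Matrix.map_mul, Matrix.map_mul] at this
      exact this
    exact (((Commute.one_left _).smul_left _).sub_left
      ((Commute.refl _).smul_left _)).sub_left hB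
  -- Induction on a degree bound for a kernel vector `v`. The coefficient of degree `d + 2` in `M v`
  -- shows that `A` kills the top coefficient of `v`; so `A v`, again in the kernel by
  -- commutativity, has lower degree and is zero. Then `k X v = B v` forces the top coefficient of
  -- `v` itself to vanish.
  have key : ∀ (d : ℕ) (v : n → F[X]), (∀ x i, d ≤ i → (v x).coeff i = 0) →
      M.mulVec v = 0 → v = 0 := by
    intro d
    induction d with
    | zero =>
      intro v hv _
      ext x i
      exact hv x i i.zero_le
    | succ d ih =>
      intro v hv hMv0
      have hA : (A.map C).mulVec v = 0 := by
        apply ih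
        · intro x i hi
          rcases hi.eq_or_lt with rfl | hlt
          · have h := congrArg (fun q : F[X] => q.coeff (d + 2)) (congrFun (hMv v ▸ hMv0) x)
            simp only [Pi.sub_apply, Pi.smul_apply, smul_eq_mul, coeff_sub, Pi.zero_apply,
              coeff_zero] at h
            rw [mul_assoc, coeff_C_mul, coeff_X_mul, hv x (d + 1) le_rfl, coeff_X_pow_mul,
              hcoeff B v x (d + 2) fun y => hv y _ (by omega)] at h
            simpa using h
          · exact hcoeff A v x i fun y => hv y i hlt
        · rw [Matrix.mulVec_mulVec, hcomm.eq, ← Matrix.mulVec_mulVec, hMv0, Matrix.mulVec_zero]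
      apply ih v _ hMv0
      intro x i hi
      rcases hi.eq_or_lt with rfl | hlt
      · have h := congrArg (fun q : F[X] => q.coeff (d + 1)) (congrFun (hMv v ▸ hMv0) x)
        simp only [hA, Pi.sub_apply, Pi.smul_apply, smul_eq_mul, coeff_sub, Pi.zero_apply,
          coeff_zero, mul_zero] at h
        rw [mul_assoc, coeff_C_mul, coeff_X_mul,
          hcoeff B v x (d + 1) fun y => hv y _ le_rfl] at h
        simpa [hk] using h
      · exact hv x i hlt
  intro hdet
  obtain ⟨v, hv, hv0⟩ := Matrix.exists_mulVec_eq_zero_iff.2 hdet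
  refine hv (key (Finset.univ.sup fun x => (v x).natDegree + 1) v (fun x i hi => ?_) hv0)
  apply coeff_eq_zero_of_natDegree_lt
  exact (Finset.le_sup (f := fun x => (v x).natDegree + 1) (Finset.mem_univ x)).trans hi

namespace DiMultigraph

variable {V : Type u} {E : Type v} [DecidableEq V] [Fintype E]

section Degrees

variable {R : Type*} [CommRing R]

theorem sum_single_src (X : DiMultigraph V E) (x : V) :
    ∑ e, (Pi.single (X.src e) 1 : V → R) x = X.outDegree x := by
  rw [outDegree, Nat.card_eq_fintype_card, Fintype.card_subtype]
  simp [Pi.single_apply, eq_comm]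

theorem sum_single_tgt (X : DiMultigraph V E) (x : V) :
    ∑ e, (Pi.single (X.tgt e) 1 : V → R) x = X.inDegree x := by
  rw [inDegree, Nat.card_eq_fintype_card, Fintype.card_subtype]
  simp [Pi.single_apply, eq_comm]

theorem sum_single_src_mul_single_tgt (X : DiMultigraph V E) (x y : V) :
    ∑ e, (Pi.single (X.src e) 1 : V → R) x * (Pi.single (X.tgt e) 1 : V → R) y =
      (X.adjMatrix x y : R) := by
  rw [adjMatrix, Matrix.of_apply, Nat.card_eq_fintype_card, Fintype.card_subtype]
  simp [Pi.single_apply, ← ite_and, eq_comm, and_comm]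

theorem twistedLaplacian_const (X : DiMultigraph V E) (u : Rˣ) (x y : V) :
    X.twistedLaplacian (fun _ => u) x y =
      (if x = y then ((X.inDegree x + X.outDegree x : ℕ) : R) else 0) -
        u * X.adjMatrix x y - (u⁻¹ : Rˣ) * X.adjMatrix y x := by
  rw [← sum_single_src_mul_single_tgt, ← sum_single_src_mul_single_tgt, Nat.cast_add,
    ← sum_single_src, ← sum_single_tgt, twistedLaplacian_apply, Finset.mul_sum, Finset.mul_sum]
  split_ifs with h
  · subst h
    rw [← Finset.sum_add_distrib, ← Finset.sum_sub_distrib, ← Finset.sum_sub_distrib]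
    refine Finset.sum_congr rfl fun e _ => ?_
    have h1 : ∀ z : V, (Pi.single z (1 : R) : V → R) x * (Pi.single z (1 : R) : V → R) x =
        (Pi.single z (1 : R) : V → R) x := by
      intro z
      by_cases hz : x = z
      · simp [hz]
      · simp [hz]
    linear_combination h1 (X.src e) + (((u⁻¹ : Rˣ) : R) * u) * h1 (X.tgt e) +
      (Pi.single (X.tgt e) (1 : R) : V → R) x * u.inv_mul
  · rw [zero_sub, ← Finset.sum_neg_distrib, ← Finset.sum_sub_distrib]
    refine Finset.sum_congr rfl fun e _ => ?_
    have h1 : ∀ z : V, (Pi.single z (1 : R) : V → R) x * (Pi.single z (1 : R) : V → R) y = 0 := by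
      intro z
      by_cases hz : x = z
      · simp [← hz, Ne.symm h]
      · simp [hz]
    linear_combination h1 (X.src e) + (((u⁻¹ : Rˣ) : R) * u) * h1 (X.tgt e)

variable [Fintype V]

/-- The two Laplacians are conjugate by the diagonal matrix of `g`. -/
theorem det_twistedLaplacian_gauge (X : DiMultigraph V E) (c c' : E → Rˣ) (g : V → Rˣ)
    (hc : ∀ e, c e = c' e * g (X.src e) * (g (X.tgt e))⁻¹) :
    (X.twistedLaplacian c).det = (X.twistedLaplacian c').det := by
  have h : X.twistedLaplacian c =
      Matrix.diagonal (fun x => (g x : R)) * X.twistedLaplacian c' *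
        Matrix.diagonal (fun x => ((g x)⁻¹ : Rˣ) : V → R) := by
    ext x y
    rw [Matrix.mul_diagonal, Matrix.diagonal_mul, twistedLaplacian_apply, twistedLaplacian_apply,
      Finset.mul_sum, Finset.sum_mul]
    refine Finset.sum_congr rfl fun e _ => ?_
    have h1 : ∀ (f : V → R) (z w : V), f w * (Pi.single z (1 : R) : V → R) w =
        f z * (Pi.single z (1 : R) : V → R) w := by
      intro f z w
      by_cases hz : w = z
      · rw [hz]
      · simp [hz]
    have hx : (Pi.single (X.src e) 1 : V → R) x - ((c e)⁻¹ : Rˣ) *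
        (Pi.single (X.tgt e) 1 : V → R) x = ((g (X.src e))⁻¹ : Rˣ) * (g x *
        ((Pi.single (X.src e) 1 : V → R) x - ((c' e)⁻¹ : Rˣ) *
        (Pi.single (X.tgt e) 1 : V → R) x)) := by
      have h2 := h1 (fun x => (g x : R)) (X.src e) x
      have h3 := h1 (fun x => (g x : R)) (X.tgt e) x
      have h4 : ((c e)⁻¹ : Rˣ) = (g (X.src e))⁻¹ * (c' e)⁻¹ * g (X.tgt e) := by
        rw [hc, mul_inv, mul_inv, inv_inv, mul_comm (c' e)⁻¹]
      rw [h4]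
      push_cast
      linear_combination (-(((g (X.src e))⁻¹ : Rˣ) : R)) * h2 +
        (((g (X.src e))⁻¹ : Rˣ) : R) * (((c' e)⁻¹ : Rˣ) : R) * h3 -
        (Pi.single (X.src e) 1 : V → R) x * (g (X.src e)).inv_mul
    have hy : (Pi.single (X.src e) 1 : V → R) y - (c e : R) *
        (Pi.single (X.tgt e) 1 : V → R) y = g (X.src e) * (((g y)⁻¹ : Rˣ) *
        ((Pi.single (X.src e) 1 : V → R) y - (c' e : R) *
        (Pi.single (X.tgt e) 1 : V → R) y)) := by
      have h2 := h1 (fun x => (((g x)⁻¹ : Rˣ) : R)) (X.src e) y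
      have h3 := h1 (fun x => (((g x)⁻¹ : Rˣ) : R)) (X.tgt e) y
      rw [hc]
      push_cast
      linear_combination (-(g (X.src e) : R)) * h2 + (g (X.src e) : R) * (c' e : R) * h3 -
        (Pi.single (X.src e) 1 : V → R) y * (g (X.src e)).inv_mul
    rw [hx, hy]
    linear_combination ((g x : R) *
        ((Pi.single (X.src e) 1 : V → R) x - ((c' e)⁻¹ : Rˣ) *
        (Pi.single (X.tgt e) 1 : V → R) x)) * (((g y)⁻¹ : Rˣ) *
        ((Pi.single (X.src e) 1 : V → R) y - (c' e : R) *
        (Pi.single (X.tgt e) 1 : V → R) y)) * (g (X.src e)).inv_mul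
  rw [h, Matrix.det_mul, Matrix.det_mul, Matrix.det_diagonal, Matrix.det_diagonal, mul_right_comm,
    ← Finset.prod_mul_distrib]
  simp

end Degrees

variable [Fintype V] (p : ℕ) [hp : Fact p.Prime]

/-- After `T ↦ T ^ (p ^ n₀)` the exponent at `e` is `1 + h (src e) - h (tgt e)`, a gauge transform
of the constant `1`. The criterion thereby loses all reference to `h` and `n₀`. -/
theorem voltageDet_reducedVoltage_eq_zero_iff {X : DiMultigraph V E} {h : V → ℤ} {n₀ : ℕ} {d' : ℤ}
    (hX : X.IsPotential h ((p : ℤ) ^ n₀ * d')) :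
    X.voltageDet (X.reducedVoltage h ((p : ℤ) ^ n₀)) (ZMod p) = 0 ↔
      (X.twistedLaplacian fun _ => laurentVar (ZMod p)).det = 0 := by
  rw [← det_twistedLaplacian_laurentVar_pow_eq_zero X _ (pow_pos hp.out.pos n₀),
    det_twistedLaplacian_gauge X _ (fun _ => laurentVar (ZMod p))
      (fun x => laurentVar (ZMod p) ^ h x)]
  intro e
  have h1 := hX.mul_reducedVoltage (dvd_mul_right _ _) e
  rw [← zpow_natCast, ← zpow_mul, Nat.cast_pow, h1, zpow_sub, zpow_add, zpow_one]

open LaurentPolynomial in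
-- The all-ones vector is mapped to `(1 - T) (out - T⁻¹ in)` at each vertex, which is zero modulo
-- `p`.
theorem det_twistedLaplacian_eq_zero_of_dvd [Nonempty V] {X : DiMultigraph V E}
    (hdeg : ∀ x, p ∣ X.inDegree x ∧ p ∣ X.outDegree x) :
    (X.twistedLaplacian fun _ => laurentVar (ZMod p)).det = 0 := by
  rw [← Matrix.exists_mulVec_eq_zero_iff]
  refine ⟨fun _ => 1, fun h => ?_, ?_⟩
  · simpa using congrFun h (Classical.arbitrary V)
  · ext1 x
    simp only [Matrix.mulVec, dotProduct, mul_one, twistedLaplacian_apply, Pi.zero_apply]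
    rw [Finset.sum_comm]
    have hcast : ∀ m : ℕ, p ∣ m → (m : (ZMod p)[T;T⁻¹]) = 0 := by
      intro m hm
      rw [← map_natCast (C : ZMod p →+* (ZMod p)[T;T⁻¹]), (ZMod.natCast_eq_zero_iff m p).2 hm,
        map_zero]
    have hin : ∀ z : V, ∑ y, (Pi.single z 1 : V → (ZMod p)[T;T⁻¹]) y = 1 := fun z => by simp
    simp only [← Finset.mul_sum, Finset.sum_sub_distrib, hin, ← Finset.sum_mul]
    rw [sum_single_src, sum_single_tgt, hcast _ (hdeg x).1, hcast _ (hdeg x).2]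
    simp

open LaurentPolynomial in
-- Multiplied by `T`, the Laplacian becomes the matrix polynomial `k T - T ^ 2 A - Aᵗ`, and
-- normality of `A` survives reduction modulo `p`.
theorem det_twistedLaplacian_ne_zero_of_normal {X : DiMultigraph V E} {k : ℕ}
    (hdeg : ∀ x, X.inDegree x + X.outDegree x = k) (hk : ¬ p ∣ k)
    (hnormal : X.adjMatrix * X.adjMatrix.transpose = X.adjMatrix.transpose * X.adjMatrix) :
    (X.twistedLaplacian fun _ => laurentVar (ZMod p)).det ≠ 0 := by
  set A : Matrix V V (ZMod p) := X.adjMatrix.map (Int.castRingHom (ZMod p)) with hA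
  have hcomm : Commute A A.transpose := by
    have := congrArg (fun N : Matrix V V ℤ => N.map (Int.castRingHom (ZMod p))) hnormal
    rw [Matrix.map_mul, Matrix.map_mul] at this
    exact this
  have hk' : (k : ZMod p) ≠ 0 := fun h => hk ((ZMod.natCast_eq_zero_iff k p).1 h)
  have hne := Matrix.det_quadratic_ne_zero_of_commute hcomm hk'
  intro h0
  apply hne
  rw [← Polynomial.toLaurent_eq_zero]
  have hmat : ((Polynomial.C (k : ZMod p) * Polynomial.X : Polynomial (ZMod p)) •
      (1 : Matrix V V (Polynomial (ZMod p))) - (Polynomial.X ^ 2 : Polynomial (ZMod p)) •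
      A.map Polynomial.C - A.transpose.map Polynomial.C).map Polynomial.toLaurent =
      (laurentVar (ZMod p) : (ZMod p)[T;T⁻¹]) •
        X.twistedLaplacian fun _ => laurentVar (ZMod p) := by
    have hT : ((laurentVar (ZMod p) : ((ZMod p)[T;T⁻¹])ˣ) : (ZMod p)[T;T⁻¹]) = T 1 := rfl
    ext1 x y
    rw [Matrix.smul_apply, twistedLaplacian_const, hdeg]
    simp only [Matrix.map_apply, Matrix.sub_apply, Matrix.smul_apply, smul_eq_mul, map_sub, map_mul,
      Polynomial.toLaurent_X, map_pow, hA, Matrix.transpose_apply,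
      Matrix.one_apply, apply_ite (Polynomial.toLaurent (R := ZMod p)), map_one, map_zero,
      map_natCast, eq_intCast, map_intCast, ← hT]
    split_ifs <;> linear_combination (X.adjMatrix y x : (ZMod p)[T;T⁻¹]) *
      (laurentVar (ZMod p)).mul_inv
  have hdet := congrArg Matrix.det hmat
  rw [Matrix.det_smul, h0, mul_zero] at hdet
  rw [← hdet]
  exact RingHom.map_det _ _

end DiMultigraph

theorem theoremB (p : ℕ) [Fact p.Prime] {V : Type u} {E : Type v} [Fintype V] [Fintype E]
    (X : DiMultigraph V E) (hconn : X.Connected) (hcycle : X.HasCycleOfNonzeroWeight) :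
    ∃ μ : ℤ, X.HasMuInvariant p μ ∧
      ((∀ x : V, p ∣ X.inDegree x ∧ p ∣ X.outDegree x) → 0 < μ) ∧
      ((∃ k : ℕ, (∀ x : V, X.inDegree x + X.outDegree x = k) ∧ ¬ p ∣ k) →
        X.adjMatrix * X.adjMatrix.transpose = X.adjMatrix.transpose * X.adjMatrix → μ = 0) := by
  classical
  have hp : p.Prime := Fact.out
  have : Nonempty V := hconn.nonempty
  obtain ⟨h, d, hX⟩ := DiMultigraph.exists_isPotential hconn hcycle
  have hpZ : Prime (p : ℤ) := Nat.prime_iff_prime_int.1 hp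
  obtain ⟨d', hd, hpd'⟩ :=
    (FiniteMultiplicity.of_not_isUnit hpZ.not_isUnit hX.ne_zero).exists_eq_pow_mul_and_not_dvd
  set n₀ := multiplicity (p : ℤ) d
  rw [hd] at hX
  have hcop : IsCoprime d' p := (hpZ.irreducible.coprime_iff_not_dvd.2 hpd').symm
  obtain ⟨μ, hμ, lam, ν, hgrowth⟩ :=
    DiMultigraph.exists_padicValNat_numSpanningTrees_derived p X
      (X.reducedVoltage h ((p : ℤ) ^ n₀))
      fun m => DiMultigraph.numSpanningTrees_ne_zero (hX.connected_derived p hcop m)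
  rw [ne_eq, DiMultigraph.voltageDet_reducedVoltage_eq_zero_iff p hX] at hμ
  refine ⟨μ, fun a ha => ⟨n₀, DiMultigraph.isStableIndex hX hcop ha, fun c => ⟨lam, ν, ?_⟩⟩,
    fun hdeg => ?_, fun ⟨k, hdeg, hk⟩ hnormal => ?_⟩
  · filter_upwards [hgrowth] with m hm
    rw [DiMultigraph.numSpanningTrees_towerLayer hX hcop ha c m, hm]
  · rw [Nat.cast_pos, Nat.pos_iff_ne_zero]
    intro h0
    exact hμ.1 h0 (DiMultigraph.det_twistedLaplacian_eq_zero_of_dvd p hdeg)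
  · rw [Nat.cast_eq_zero]
    exact hμ.2 (DiMultigraph.det_twistedLaplacian_ne_zero_of_normal p hdeg hk hnormal)
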